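/- **Theorem 2.6.** Let $\Omega=(l_1,l_2)\times(l_3,l_4)$ with $l_4-l_3=N_0(l_2-l_1)$, $N_0\in\{1,2,\dots\}$, let $\psi$ be smooth and let $\Gamma_I=\{p\in\Omega:\psi(p)=0\}$ be the interface, where the corner $(l_1,l_4)$ is not in $\overline{\Gamma_I}$. Put $D=\overline\Omega\setminus\overline{\Gamma_I}$. For $N_1\in\{1,2,\dots\}$ let $N_2=N_0N_1$, $h=(l_2-l_1)/N_1$, $x_i=l_1+ih$, $y_j=l_3+jh$, so that $(x_0,y_{N_2})=(l_1,l_4)$. Consider $$-\nabla\cdot(a\nabla u)=f \text{ in } \Omega\setminus\Gamma_I,\qquad -u_x+\alpha(y)u=g_1 \text{ on } \Gamma_1=\{l_1\}\times(l_3,l_4),\qquad u_y+\beta(x)u=g_4 \text{ on } \Gamma_4=(l_1,l_2)\times\{l_4\},$$ the boundary conditions being imposed at the points of $\Gamma_1\cap D$ and of $\Gamma_4\cap D$, with $a>0$ on $D$ (the jumps across $\Gamma_I$ and the boundary values on the other two sides are arbitrary). A *4-point scheme* at $(x_0,y_{N_2})$ is a relation $$\sum_{k\in\{0,1\}}\ \sum_{\ell\in\{-1,0\}}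 C_{k,\ell}(h)\,u_{k,N_2+\ell}=\sum_{m+n\le M-1} f^{(m,n)}C_{f,m,n}(h)+\sum_{n=0}^{M} g_1^{(n)}C_{g_1,n}(h)+\sum_{n=0}^{M} g_4^{(n)}C_{g_4,n}(h)$$ with some integer $M\ge0$ and coefficients that are functions of $h$ (not depending on $u,f,g_1,g_4$), where $f^{(m,n)}=\partial_x^m\partial_y^n f(l_1,l_4)$, $g_1^{(n)}=g_1^{(n)}(l_4)$, $g_4^{(n)}=g_4^{(n)}(l_1)$. It is *non-trivial* if the $C_{k,\ell}(h)$ do not all tend to $0$ as $h\to0$. It has *order $p$* for $a,\alpha,\beta$ if for every sufficiently smooth exact solution $u$ (with data $f,g_1,g_4$) the relation with $u_{i,j}=u(x_i,y_j)$ holds up to an error $O(h^{p+1})$ as $h\to0$, $h=(l_2-l_1)/N_1$. Then: 1. Let $a\in C^6(D)$, $\alpha\in C^5([l_3,l_4])$, $\beta\in C^5([l_1,l_2])$. There is a 4-point scheme with $M=5$ which has order six, tested on all solutions $u\in C^7(D)$ with $f\in C^5(D)$, $g_1\in C^5([l_3,l_4])$, $g_4\in C^5([l_1,l_2])$. All its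 coefficients are polynomials in $h$, the $C_{k,\ell}$ have degree at most $6$ and $C_{k,\ell}(0)\ne0$ for all four $(k,\ell)$, and the coefficients are determined by $\partial_x^m\partial_y^n a(l_1,l_4)$, $m+n\le5$, and by $\alpha^{(n)}(l_4)$, $\beta^{(n)}(l_1)$, $n\le5$. 2. For 2 and 3, order is tested on solutions $u\in C^\infty(D)$ with $C^\infty$ data $f$ on $D$, $g_1$ on $[l_3,l_4]$, $g_4$ on $[l_1,l_2]$. Six is the maximum order for smooth coefficients with $\alpha(y_{N_2})\ne\beta(x_0)$: for all real $\alpha_0\ne\beta_0$, the largest integer $p$ such that for all $C^\infty$ functions $a>0$ on $D$, $\alpha$ on $[l_3,l_4]$, $\beta$ on $[l_1,l_2]$ with $\alpha(l_4)=\alpha_0$, $\beta(l_1)=\beta_0$ there is a non-trivial 4-point scheme (with any $M$) of order $p$ is $p=6$. 3. In particular, if $a>0$ is $C^\infty$ on $D$ and constant near the corner, and $\alpha$, $\beta$ are constant functions with $\alpha\ne\beta$, then no non-trivial 4-point scheme (with any $M$) has order greater than six for $a,\alpha,\beta$. -/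

import Mathlib

open Set Filter Topology Asymptotics
open scoped ContDiff

noncomputable section

namespace CornerFD

/-- The rectangle `Ω = (l₁, l₂) × (l₃, l₄)` with `l₄ - l₃ = N₀ (l₂ - l₁)`, together with the level
function `ψ` of the interface `Γ_I = {ψ = 0} ∩ Ω`.  The interface keeps away from the corner
`(l₁, l₄)`, so that all sufficiently small stencils at that corner lie on one side of it. -/
structure InterfaceDomain where
  l₁ : ℝ
  l₂ : ℝ
  l₃ : ℝ
  l₄ : ℝ
  N₀ : ℕ
  ψ : ℝ × ℝ → ℝ
  l₁_lt_l₂ : l₁ < l₂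
  N₀_pos : 0 < N₀
  sides : l₄ - l₃ = N₀ * (l₂ - l₁)
  smooth_ψ : ContDiff ℝ ∞ ψ
  corner_notMem : (l₁, l₄) ∉ closure {p : ℝ × ℝ | p ∈ Ioo l₁ l₂ ×ˢ Ioo l₃ l₄ ∧ ψ p = 0}

namespace InterfaceDomain

variable (G : InterfaceDomain)

/-- The open rectangle. -/
def Ω : Set (ℝ × ℝ) := Ioo G.l₁ G.l₂ ×ˢ Ioo G.l₃ G.l₄

/-- The interface curve. -/
def ΓI : Set (ℝ × ℝ) := {p | p ∈ G.Ω ∧ G.ψ p = 0}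

/-- The left side `{l₁} × (l₃, l₄)`. -/
def Γ₁ : Set (ℝ × ℝ) := {G.l₁} ×ˢ Ioo G.l₃ G.l₄

/-- The top side `(l₁, l₂) × {l₄}`. -/
def Γ₄ : Set (ℝ × ℝ) := Ioo G.l₁ G.l₂ ×ˢ {G.l₄}

/-- The closed rectangle without the closed interface: the set on which the data and the solution
are smooth, up to the boundary of the rectangle.  It is relatively open in the closed rectangle. -/
def D : Set (ℝ × ℝ) := closure G.Ω \ closure G.ΓI

/-- The corner where the left and the top side meet. -/
def corner : ℝ × ℝ := (G.l₁, G.l₄)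

/-- First partial derivative in `x` on `G.D`: the ordinary one at interior points, one-sided (within
the closed rectangle) at boundary points. -/
def pdx (w : ℝ × ℝ → ℝ) : ℝ × ℝ → ℝ := fun p => fderivWithin ℝ w G.D p (1, 0)

/-- First partial derivative in `y` on `G.D`. -/
def pdy (w : ℝ × ℝ → ℝ) : ℝ × ℝ → ℝ := fun p => fderivWithin ℝ w G.D p (0, 1)

/-- The partial derivative `w^{(m,n)} = ∂^{m+n} w / ∂x^m ∂y^n` at the corner. -/
def cornerDeriv (w : ℝ × ℝ → ℝ) (m n : ℕ) : ℝ := (G.pdx^[m] (G.pdy^[n] w)) G.corner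

/-- The `n`-th derivative at `l₄` of a function of `y` on the left side. -/
def leftDeriv (g : ℝ → ℝ) (n : ℕ) : ℝ := iteratedDerivWithin n g (Icc G.l₃ G.l₄) G.l₄

/-- The `n`-th derivative at `l₁` of a function of `x` on the top side. -/
def topDeriv (g : ℝ → ℝ) (n : ℕ) : ℝ := iteratedDerivWithin n g (Icc G.l₁ G.l₂) G.l₁

/-- The grid size `h = (l₂ - l₁) / N₁`. -/
def gridSize (N₁ : ℕ) : ℝ := (G.l₂ - G.l₁) / N₁

/-- The grid point `(x_k, y_{N₂ - j})`, where `x_i = l₁ + i h`, `y_i = l₃ + i h`, `N₂ = N₀ N₁`. -/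
def gridPoint (N₁ : ℕ) (k j : Fin 2) : ℝ × ℝ :=
  (G.l₁ + ((k : ℕ) : ℝ) * G.gridSize N₁,
   G.l₃ + ((G.N₀ * N₁ : ℝ) - ((j : ℕ) : ℝ)) * G.gridSize N₁)

end InterfaceDomain

/-- The coefficients of the problem: `a(x, y)` of the elliptic operator, `α(y)` of the Robin
condition on the left side and `β(x)` of the Robin condition on the top side. -/
structure Coeffs where
  a : ℝ × ℝ → ℝ
  α : ℝ → ℝ
  β : ℝ → ℝ

/-- Regularity of the coefficients at level `s`: `a` is positive and of class `C^{s+1}` off the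
interface and up to the boundary, `α` and `β` are of class `C^s`. -/
structure Coeffs.IsRegular (c : Coeffs) (G : InterfaceDomain) (s : ℕ∞) : Prop where
  a_pos : ∀ p ∈ G.D, 0 < c.a p
  a_smooth : ContDiffOn ℝ ((s + 1 : ℕ∞) : WithTop ℕ∞) c.a G.D
  α_smooth : ContDiffOn ℝ (s : WithTop ℕ∞) c.α (Icc G.l₃ G.l₄)
  β_smooth : ContDiffOn ℝ (s : WithTop ℕ∞) c.β (Icc G.l₁ G.l₂)

/-- `u` is an exact solution, of class `C^{s+2}` off the interface and up to the boundary, of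
`-∇·(a∇u) = f` in `Ω \ Γ_I` with `∂u/∂n + α u = g₁` on the left side and `∂u/∂n + β u = g₄` on the
top side (`n` is the outward normal), the data `f`, `g₁`, `g₄` being of class `C^s`.

The jumps of `u` and of its flux across the interface and the boundary values on the two other
sides are arbitrary data of the interface problem.  Every `u` as here has such data, none of which
enters a scheme at the corner, so they are not named. -/
structure IsSolution (G : InterfaceDomain) (c : Coeffs) (s : ℕ∞)
    (u f : ℝ × ℝ → ℝ) (g₁ g₄ : ℝ → ℝ) : Prop where
  u_smooth : ContDiffOn ℝ ((s + 2 : ℕ∞) : WithTop ℕ∞) u G.D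
  f_smooth : ContDiffOn ℝ (s : WithTop ℕ∞) f G.D
  g₁_smooth : ContDiffOn ℝ (s : WithTop ℕ∞) g₁ (Icc G.l₃ G.l₄)
  g₄_smooth : ContDiffOn ℝ (s : WithTop ℕ∞) g₄ (Icc G.l₁ G.l₂)
  pde : ∀ p ∈ G.Ω \ G.ΓI,
    -(G.pdx (fun q => c.a q * G.pdx u q) p + G.pdy (fun q => c.a q * G.pdy u q) p) = f p
  robin_left : ∀ p ∈ G.Γ₁ ∩ G.D, -G.pdx u p + c.α p.2 * u p = g₁ p.2
  robin_top : ∀ p ∈ G.Γ₄ ∩ G.D, G.pdy u p + c.β p.1 * u p = g₄ p.1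

/-- A 4-point scheme at the corner.  `C k j` is the coefficient, as a function of the grid size `h`,
of the unknown at `(x_k, y_{N₂ - j})`; the right-hand side is a combination of the derivatives
`f^{(m,n)}` with `m + n ≤ M - 1` and of the derivatives of `g₁` and `g₄` of orders `0, …, M`
at the corner, whose coefficients are functions of `h` too. -/
structure CornerScheme where
  M : ℕ
  C : Fin 2 → Fin 2 → ℝ → ℝ
  Cf : ℕ → ℕ → ℝ → ℝ
  Cg₁ : ℕ → ℝ → ℝ
  Cg₄ : ℕ → ℝ → ℝ

namespace CornerScheme

variable (S : CornerScheme)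

/-- The left-hand side of the scheme evaluated at `u`, on the grid with parameter `N₁`. -/
def lhs (G : InterfaceDomain) (u : ℝ × ℝ → ℝ) (N₁ : ℕ) : ℝ :=
  ∑ k : Fin 2, ∑ j : Fin 2, S.C k j (G.gridSize N₁) * u (G.gridPoint N₁ k j)

/-- The right-hand side of the scheme, on the grid with parameter `N₁`. -/
def rhs (G : InterfaceDomain) (f : ℝ × ℝ → ℝ) (g₁ g₄ : ℝ → ℝ) (N₁ : ℕ) : ℝ :=
  (∑ d ∈ Finset.range S.M, ∑ q ∈ Finset.HasAntidiagonal.antidiagonal d,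
      G.cornerDeriv f q.1 q.2 * S.Cf q.1 q.2 (G.gridSize N₁))
  + ∑ n ∈ Finset.range (S.M + 1), G.leftDeriv g₁ n * S.Cg₁ n (G.gridSize N₁)
  + ∑ n ∈ Finset.range (S.M + 1), G.topDeriv g₄ n * S.Cg₄ n (G.gridSize N₁)

/-- The scheme has order of accuracy `p` for the two Robin conditions at the corner, tested on the
solutions of regularity level `s`: for every exact solution the scheme holds up to `O(h^{p+1})` as
`h → 0`.  (The scheme is `h` times a discretization of first-order boundary conditions, hence the
exponent `p + 1`.) -/
def HasOrder (G : InterfaceDomain) (c : Coeffs) (s : ℕ∞) (p : ℕ) : Prop :=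
  ∀ (u f : ℝ × ℝ → ℝ) (g₁ g₄ : ℝ → ℝ), IsSolution G c s u f g₁ g₄ →
    (fun N₁ : ℕ => S.lhs G u N₁ - S.rhs G f g₁ g₄ N₁)
      =O[atTop] (fun N₁ : ℕ => G.gridSize N₁ ^ (p + 1))

/-- The stencil is non-trivial: its coefficients do not all tend to zero with the grid size. -/
def Nontrivial (G : InterfaceDomain) : Prop :=
  ¬ ∀ k j, Tendsto (fun N₁ : ℕ => S.C k j (G.gridSize N₁)) atTop (𝓝 0)

/-- The stencil coefficients are polynomials in `h` of degree at most `d`, and those of the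
right-hand side are polynomials in `h`. -/
structure IsPolynomial (d : ℕ) : Prop where
  C_poly : ∀ k j, ∃ P : Polynomial ℝ, P.natDegree ≤ d ∧ ∀ h, S.C k j h = P.eval h
  Cf_poly : ∀ m n, ∃ P : Polynomial ℝ, ∀ h, S.Cf m n h = P.eval h
  Cg₁_poly : ∀ n, ∃ P : Polynomial ℝ, ∀ h, S.Cg₁ n h = P.eval h
  Cg₄_poly : ∀ n, ∃ P : Polynomial ℝ, ∀ h, S.Cg₄ n h = P.eval h

end CornerScheme

/-- Values of derivatives at the corner of the three coefficients of the problem. -/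
structure CornerJet where
  a : ℕ → ℕ → ℝ
  α : ℕ → ℝ
  β : ℕ → ℝ

/-- The jet of order `M` of the coefficients at the corner: the derivatives `a^{(m,n)}` with
`m + n ≤ M`, and `α^{(n)}`, `β^{(n)}` with `n ≤ M` (entries of higher order are set to zero). -/
def Coeffs.jet (c : Coeffs) (G : InterfaceDomain) (M : ℕ) : CornerJet where
  a := fun m n => if m + n ≤ M then G.cornerDeriv c.a m n else 0
  α := fun n => if n ≤ M then G.leftDeriv c.α n else 0
  β := fun n => if n ≤ M then G.topDeriv c.β n else 0

end CornerFD

end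

/-! Existence. Modulo the data, the differentiated equation expresses `u^{(m,n+2)}` as
`-u^{(m+2,n)}` plus derivatives of lower order, and the differentiated Robin conditions express
`u^{(1,n)}` and `u^{(m,1)}` by lower ones. To leading order this is the Laplace equation with
Neumann conditions on both sides, whose homogeneous polynomial solutions are the multiples of `Re (x
+ i y) ^ (2 k)`. Induction on the order leaves only `u^{(2k,0)}`, `k < 4`, free up to order six
(`IsHomogeneousJet.exists_elimination`). Here "modulo the data" is literal: corner derivatives are
functionals on formal solutions, taken in the quotient by the combinations of data. Stencil weights
that annihilate the Taylor expansion in this quotient are a scheme, and membership in the range of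
`dataFunctional` supplies its right-hand side.

There remain four weights against four functions, the `i`-th beginning with `h ^ (2 i)`. The cross
product of the rows `i = 1, 2` over the three points off the corner annihilates both rows exactly,
and the corner weight takes care of `i = 0`. In the row `i = 3` only the `h ^ 6` term matters. It
vanishes by symmetry: reflection in the diagonal through the corner swaps two of the points and
fixes the third, `Re (x + i y) ^ 6` is odd under it, and the limiting weights `1/12, 1/12, 1/24` are
even (`exists_stencil`).

Optimality. For `a` constant near the corner and constant `α`, `β`, the harmonic polynomials
`robinHarmonic` with `n < 4` are solutions all of whose data vanish to infinite order at the corner,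
so no right-hand side can help. Order seven makes their four left-hand sides `O(h ^ 8)`. With row
`n` divided by `h ^ (2 n)`, the determinant of this system vanishes at `h = 0` by the same
reflection, but `α ≠ β` breaks the symmetry at first order and the zero is simple. Cramer's rule
then sends every weight to zero (`tendsto_zero_of_isBigO`). -/

namespace CornerFD

/-! ### Iterated directional derivatives within a set -/

section Calculus

/-- The derivative of `w` within `D` in the direction `v`. -/
noncomputable def pd (D : Set (ℝ × ℝ)) (v : ℝ × ℝ) (w : ℝ × ℝ → ℝ) : ℝ × ℝ → ℝ :=
  fun p => fderivWithin ℝ w D p v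

variable {D : Set (ℝ × ℝ)} {v v' : ℝ × ℝ} {w w' : ℝ × ℝ → ℝ}

theorem contDiffOn_pd (hD : UniqueDiffOn ℝ D) {n m : WithTop ℕ∞} (hw : ContDiffOn ℝ n w D)
    (hmn : m + 1 ≤ n) : ContDiffOn ℝ m (pd D v w) D :=
  (hw.fderivWithin hD hmn).clm_apply contDiffOn_const

theorem contDiffOn_pd_iterate (hD : UniqueDiffOn ℝ D) (k : ℕ) :
    ∀ {n : ℕ} {w : ℝ × ℝ → ℝ}, ContDiffOn ℝ ((n + k : ℕ) : WithTop ℕ∞) w D →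
      ContDiffOn ℝ (n : WithTop ℕ∞) ((pd D v)^[k] w) D := by
  induction k with
  | zero => intro n w hw; simpa using hw
  | succ k ih =>
    intro n w hw
    rw [Function.iterate_succ_apply]
    refine ih (contDiffOn_pd hD hw ?_)
    norm_cast

theorem pd_congr (h : EqOn w w' D) : EqOn (pd D v w) (pd D v w') D := fun p hp => by
  simp only [pd]; rw [fderivWithin_congr h (h hp)]

theorem pd_iterate_congr (k : ℕ) (h : EqOn w w' D) :
    EqOn ((pd D v)^[k] w) ((pd D v)^[k] w') D := by
  induction k with
  | zero => exact h
  | succ k ih => simp only [Function.iterate_succ_apply']; exact pd_congr ih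

theorem pd_sum (hD : UniqueDiffOn ℝ D) {ι : Type*} (s : Finset ι) (c : ι → ℝ)
    (W : ι → ℝ × ℝ → ℝ) (hW : ∀ i ∈ s, ContDiffOn ℝ 1 (W i) D) :
    EqOn (pd D v (fun p => ∑ i ∈ s, c i * W i p)) (fun p => ∑ i ∈ s, c i * pd D v (W i) p) D := by
  intro p hp
  have hd : ∀ i ∈ s, DifferentiableWithinAt ℝ (W i) D p := fun i hi =>
    ((hW i hi).differentiableOn (by simp)) p hp
  simp only [pd]
  rw [fderivWithin_fun_sum (hD p hp) (fun i hi => (hd i hi).const_mul (c i)),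
    sum_apply]
  refine Finset.sum_congr rfl fun i hi => ?_
  rw [fderivWithin_const_mul (hD p hp) (hd i hi)]
  simp

theorem pd_iterate_sum (hD : UniqueDiffOn ℝ D) {ι : Type*} (s : Finset ι) (c : ι → ℝ) (m : ℕ) :
    ∀ (W : ι → ℝ × ℝ → ℝ), (∀ i ∈ s, ContDiffOn ℝ (m : WithTop ℕ∞) (W i) D) →
    EqOn ((pd D v)^[m] (fun p => ∑ i ∈ s, c i * W i p))
      (fun p => ∑ i ∈ s, c i * (pd D v)^[m] (W i) p) D := by
  induction m with
  | zero => intro W _ p _; rfl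
  | succ m ih =>
    intro W hW
    simp only [Function.iterate_succ_apply]
    refine (pd_iterate_congr m (pd_sum hD s c W fun i hi =>
      (hW i hi).of_le (by norm_cast; omega))).trans ?_
    exact ih _ fun i hi => contDiffOn_pd hD (hW i hi) (by norm_cast)

theorem pd_mul (hD : UniqueDiffOn ℝ D) (hw : ContDiffOn ℝ 1 w D) (hw' : ContDiffOn ℝ 1 w' D) :
    EqOn (pd D v (fun p => w p * w' p)) (fun p => w p * pd D v w' p + pd D v w p * w' p) D := by
  intro p hp
  simp only [pd]
  rw [fderivWithin_fun_mul (hD p hp) (hw.differentiableOn (by simp) p hp)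
    (hw'.differentiableOn (by simp) p hp)]
  simp [mul_comm]

/-- The Leibniz rule for iterated directional derivatives. -/
theorem pd_iterate_mul (hD : UniqueDiffOn ℝ D) (n : ℕ) :
    ContDiffOn ℝ (n : WithTop ℕ∞) w D → ContDiffOn ℝ (n : WithTop ℕ∞) w' D →
    EqOn ((pd D v)^[n] (fun p => w p * w' p))
      (fun p => ∑ ij ∈ Finset.HasAntidiagonal.antidiagonal n,
        (n.choose ij.1 : ℝ) * ((pd D v)^[ij.1] w p * (pd D v)^[ij.2] w' p)) D := by
  induction n with
  | zero => intro _ _ p _; simp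
  | succ n ih =>
    intro hw hw'
    have hle : (n : WithTop ℕ∞) ≤ ((n + 1 : ℕ) : WithTop ℕ∞) := by norm_cast; omega
    have hs : ∀ i ≤ n, ∀ {f : ℝ × ℝ → ℝ}, ContDiffOn ℝ ((n + 1 : ℕ) : WithTop ℕ∞) f D →
        ContDiffOn ℝ 1 ((pd D v)^[i] f) D := fun i hi f hf => by
      have := contDiffOn_pd_iterate (v := v) hD i (n := 1) (w := f)
        (hf.of_le (by norm_cast; omega))
      simpa using this
    rw [Function.iterate_succ_apply']
    refine (pd_congr (ih (hw.of_le hle) (hw'.of_le hle))).trans ?_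
    refine (pd_sum hD (Finset.HasAntidiagonal.antidiagonal n) (fun ij => (n.choose ij.1 : ℝ))
      (fun ij p => (pd D v)^[ij.1] w p * (pd D v)^[ij.2] w' p) fun ij hij => ?_).trans ?_
    · rw [Finset.HasAntidiagonal.mem_antidiagonal] at hij
      exact (hs _ (by omega) hw).mul (hs _ (by omega) hw')
    · intro p hp
      dsimp only
      rw [Finset.sum_antidiagonal_choose_succ_mul
        (fun i j => (pd D v)^[i] w p * (pd D v)^[j] w' p), ← Finset.sum_add_distrib]
      refine Finset.sum_congr rfl fun ij hij => ?_
      rw [Finset.HasAntidiagonal.mem_antidiagonal] at hij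
      rw [pd_mul hD (hs _ (by omega) hw) (hs _ (by omega) hw') hp]
      simp only [Function.iterate_succ_apply']
      rw [← hij, Nat.choose_symm_add, ← Function.iterate_succ_apply' (pd D v)]
      ring

/-- Symmetry is needed at boundary points too, the corner among them. It passes there from the
interior, hence the assumption that interior points accumulate at every point of `D`. -/
theorem pd_comm (hD : UniqueDiffOn ℝ D) (hcl : D ⊆ closure (interior D))
    (hw : ContDiffOn ℝ 2 w D) : EqOn (pd D v (pd D v' w)) (pd D v' (pd D v w)) D := by
  intro p hp
  have hd : DifferentiableWithinAt ℝ (fderivWithin ℝ w D) D p :=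
    ((hw.fderivWithin (m := 1) hD (by norm_num)).differentiableOn (by simp)) p hp
  have key : ∀ u u' : ℝ × ℝ,
      pd D u (pd D u' w) p = fderivWithin ℝ (fderivWithin ℝ w D) D p u u' := fun u u' => by
    change fderivWithin ℝ (fun q => fderivWithin ℝ w D q u') D p u = _
    rw [fderivWithin_clm_apply (hD p hp) hd (differentiableWithinAt_const u')]
    simp
  rw [key, key]
  exact (hw p hp).isSymmSndFDerivWithinAt (by simp) hD (hcl hp) hp v v'

theorem pd_iterate_comm (hD : UniqueDiffOn ℝ D) (hcl : D ⊆ closure (interior D)) (n : ℕ) :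
    ∀ {w : ℝ × ℝ → ℝ}, ContDiffOn ℝ ((n + 1 : ℕ) : WithTop ℕ∞) w D →
      EqOn ((pd D v)^[n] (pd D v' w)) (pd D v' ((pd D v)^[n] w)) D := by
  induction n with
  | zero => intro w _ p _; rfl
  | succ n ih =>
    intro w hw
    simp only [Function.iterate_succ_apply]
    refine (pd_iterate_congr n (pd_comm hD hcl (hw.of_le ?_))).trans (ih ?_)
    · norm_cast; omega
    · exact contDiffOn_pd hD hw (by norm_cast)

theorem pd_eq_combination (p : ℝ × ℝ) :
    pd D v w p = v.1 * pd D (1, 0) w p + v.2 * pd D (0, 1) w p := by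
  have : v = v.1 • ((1 : ℝ), (0 : ℝ)) + v.2 • ((0 : ℝ), (1 : ℝ)) := by ext <;> simp
  simp only [pd]
  conv_lhs => rw [this, map_add, map_smul, map_smul]
  simp

/-- The binomial formula for iterated derivatives in the direction `v`. -/
theorem pd_iterate_eq_sum (hD : UniqueDiffOn ℝ D) (hcl : D ⊆ closure (interior D)) (n : ℕ) :
    ContDiffOn ℝ (n : WithTop ℕ∞) w D →
    EqOn ((pd D v)^[n] w) (fun p => ∑ ij ∈ Finset.HasAntidiagonal.antidiagonal n,
      (n.choose ij.1 : ℝ) * (v.1 ^ ij.1 * v.2 ^ ij.2 *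
        (pd D (1, 0))^[ij.1] ((pd D (0, 1))^[ij.2] w) p)) D := by
  induction n with
  | zero => intro _ p _; simp
  | succ n ih =>
    intro hw
    rw [Function.iterate_succ_apply']
    have hs : ∀ i j, i + j ≤ n → ContDiffOn ℝ 1 ((pd D (1, 0))^[i] ((pd D (0, 1))^[j] w)) D := by
      intro i j hij
      have h1 : ContDiffOn ℝ ((1 + i : ℕ) : WithTop ℕ∞) ((pd D (0, 1))^[j] w) D :=
        contDiffOn_pd_iterate hD j (hw.of_le (by norm_cast; omega))
      simpa using contDiffOn_pd_iterate (v := ((1 : ℝ), (0 : ℝ))) hD i h1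
    refine (pd_congr (ih (hw.of_le (by norm_cast; omega)))).trans ?_
    have := pd_sum (v := v) hD (Finset.HasAntidiagonal.antidiagonal n)
      (fun ij => (n.choose ij.1 : ℝ) * (v.1 ^ ij.1 * v.2 ^ ij.2))
      (fun ij => (pd D (1, 0))^[ij.1] ((pd D (0, 1))^[ij.2] w)) fun ij hij => by
        rw [Finset.HasAntidiagonal.mem_antidiagonal] at hij
        exact hs _ _ hij.le
    simp only [mul_assoc] at this ⊢
    refine this.trans fun p hp => ?_
    dsimp only
    rw [Finset.sum_antidiagonal_choose_succ_mul
      (fun i j => v.1 ^ i * (v.2 ^ j * (pd D (1, 0))^[i] ((pd D (0, 1))^[j] w) p)),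
      ← Finset.sum_add_distrib]
    refine Finset.sum_congr rfl fun ij hij => ?_
    rw [Finset.HasAntidiagonal.mem_antidiagonal] at hij
    have hcomm : (pd D (0, 1)) ((pd D (1, 0))^[ij.1] ((pd D (0, 1))^[ij.2] w)) p
        = (pd D (1, 0))^[ij.1] ((pd D (0, 1))^[ij.2 + 1] w) p := by
      rw [Function.iterate_succ_apply']
      refine (pd_iterate_comm hD hcl ij.1 (contDiffOn_pd_iterate hD ij.2 (hw.of_le ?_)) hp).symm
      norm_cast; omega
    rw [pd_eq_combination, hcomm, Function.iterate_succ_apply' (pd D (1, 0)), ← hij,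
      Nat.choose_symm_add]
    ring

/-- Derivatives of the restriction of `w` to a line. -/
theorem iteratedDerivWithin_line (p₀ : ℝ × ℝ) {s : Set ℝ}
    (hs : UniqueDiffOn ℝ s) (hsD : ∀ t ∈ s, p₀ + t • v ∈ D) (hD : UniqueDiffOn ℝ D) (n : ℕ) :
    ∀ {w : ℝ × ℝ → ℝ}, ContDiffOn ℝ (n : WithTop ℕ∞) w D →
      ∀ t ∈ s, iteratedDerivWithin n (fun t => w (p₀ + t • v)) s t
        = (pd D v)^[n] w (p₀ + t • v) := by
  induction n with
  | zero => intro w _ t _; simp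
  | succ n ih =>
    intro w hw t ht
    rw [iteratedDerivWithin_succ', Function.iterate_succ_apply,
      ← ih (contDiffOn_pd hD hw (by norm_cast)) t ht]
    refine iteratedDerivWithin_congr (fun r hr => ?_) ht
    have h1 : HasFDerivWithinAt w (fderivWithin ℝ w D (p₀ + r • v)) D (p₀ + r • v) :=
      ((hw.differentiableOn (by simp)) _ (hsD r hr)).hasFDerivWithinAt
    have h2 : HasDerivWithinAt (fun t : ℝ => p₀ + t • v) v s r := by
      simpa using (((hasDerivAt_id r).smul_const v).const_add p₀).hasDerivWithinAt
    exact (h1.comp_hasDerivWithinAt r h2 hsD).derivWithin (hs r hr)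

/-- Derivatives within `D` depend only on the germ along `D`. This is what allows test solutions
whose source vanishes only near the corner. -/
theorem pd_eventuallyEq {p : ℝ × ℝ} (h : w =ᶠ[𝓝[D] p] w') : pd D v w =ᶠ[𝓝[D] p] pd D v w' := by
  filter_upwards [h.fderivWithin (𝕜 := ℝ)] with q hq
  simp only [pd, hq]

theorem pd_iterate_eventuallyEq {p : ℝ × ℝ} (n : ℕ) (h : w =ᶠ[𝓝[D] p] w') :
    (pd D v)^[n] w =ᶠ[𝓝[D] p] (pd D v)^[n] w' := by
  induction n with
  | zero => exact h
  | succ n ih => simp only [Function.iterate_succ_apply']; exact pd_eventuallyEq ih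

theorem pd_iterate_zero (n : ℕ) : (pd D v)^[n] (fun _ => 0) = fun _ => 0 := by
  induction n with
  | zero => rfl
  | succ n ih =>
    rw [Function.iterate_succ_apply', ih]; funext p; simp [pd]

theorem pd_eq_of_hasFDerivAt (hD : UniqueDiffOn ℝ D) {p : ℝ × ℝ} (hp : p ∈ D)
    {L : ℝ × ℝ →L[ℝ] ℝ} (h : HasFDerivAt w L p) : pd D v w p = L v := by
  simp only [pd]; rw [h.hasFDerivWithinAt.fderivWithin (hD p hp)]

end Calculus

end CornerFD

/-! ### Geometry of the domain and derivatives at the corner -/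

namespace CornerFD

namespace InterfaceDomain

variable (G : InterfaceDomain)

theorem l₃_lt_l₄ : G.l₃ < G.l₄ := by
  have h1 : (0 : ℝ) < G.N₀ := by exact_mod_cast G.N₀_pos
  have h2 := mul_pos h1 (sub_pos.2 G.l₁_lt_l₂)
  linarith [G.sides]

theorem closure_Ω : closure G.Ω = Icc G.l₁ G.l₂ ×ˢ Icc G.l₃ G.l₄ := by
  rw [Ω, closure_prod_eq, closure_Ioo G.l₁_lt_l₂.ne, closure_Ioo G.l₃_lt_l₄.ne]

theorem isOpen_Ω : IsOpen G.Ω := isOpen_Ioo.prod isOpen_Ioo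

theorem D_subset_Icc : G.D ⊆ Icc G.l₁ G.l₂ ×ˢ Icc G.l₃ G.l₄ := by
  rw [← closure_Ω]; exact sdiff_subset

theorem corner_mem_D : G.corner ∈ G.D := by
  refine ⟨?_, G.corner_notMem⟩
  rw [closure_Ω]
  exact ⟨⟨le_rfl, G.l₁_lt_l₂.le⟩, ⟨G.l₃_lt_l₄.le, le_rfl⟩⟩

/-- Removing the closed interface is intersecting with an open set, which preserves the density of
`Ω` in its closure. This density carries the equation, and the symmetry of derivatives, up to the
boundary. -/
theorem D_subset_closure_Ω_diff : G.D ⊆ closure (G.Ω \ closure G.ΓI) := fun p hp => by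
  rw [sdiff_eq, inter_comm]
  exact (isClosed_closure.isOpen_compl).inter_closure ⟨hp.2, hp.1⟩

theorem Ω_diff_subset_interior_D : G.Ω \ closure G.ΓI ⊆ interior G.D :=
  interior_maximal (sdiff_subset_sdiff_left subset_closure) (G.isOpen_Ω.sdiff isClosed_closure)

theorem D_subset_closure_interior : G.D ⊆ closure (interior G.D) :=
  G.D_subset_closure_Ω_diff.trans (closure_mono G.Ω_diff_subset_interior_D)

theorem uniqueDiffOn_D : UniqueDiffOn ℝ G.D := by
  have h : UniqueDiffOn ℝ (Icc G.l₁ G.l₂ ×ˢ Icc G.l₃ G.l₄) :=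
    (uniqueDiffOn_Icc G.l₁_lt_l₂).prod (uniqueDiffOn_Icc G.l₃_lt_l₄)
  rw [← closure_Ω] at h
  exact h.inter isClosed_closure.isOpen_compl

/-- A small square at the corner lies in `D`. -/
theorem exists_square_subset_D : ∃ δ > 0, G.l₁ + δ < G.l₂ ∧ G.l₃ < G.l₄ - δ ∧
    Icc G.l₁ (G.l₁ + δ) ×ˢ Icc (G.l₄ - δ) G.l₄ ⊆ G.D := by
  obtain ⟨ε, hε, hball⟩ := Metric.isOpen_iff.1 (isClosed_closure (s := G.ΓI)).isOpen_compl
    G.corner G.corner_notMem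
  have h1 := G.l₁_lt_l₂
  have h2 := G.l₃_lt_l₄
  refine ⟨min (ε / 2) (min ((G.l₂ - G.l₁) / 2) ((G.l₄ - G.l₃) / 2)),
    lt_min (by linarith) (lt_min (by linarith) (by linarith)), ?_, ?_, ?_⟩
  · have := (min_le_right (ε / 2) _).trans (min_le_left ((G.l₂ - G.l₁) / 2) ((G.l₄ - G.l₃) / 2))
    linarith
  · have := (min_le_right (ε / 2) _).trans (min_le_right ((G.l₂ - G.l₁) / 2) ((G.l₄ - G.l₃) / 2))
    linarith
  · rintro ⟨x, y⟩ ⟨hx, hy⟩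
    set δ := min (ε / 2) (min ((G.l₂ - G.l₁) / 2) ((G.l₄ - G.l₃) / 2)) with hδ
    have e1 : δ ≤ ε / 2 := min_le_left _ _
    have e2 : δ ≤ (G.l₂ - G.l₁) / 2 := (min_le_right _ _).trans (min_le_left _ _)
    have e3 : δ ≤ (G.l₄ - G.l₃) / 2 := (min_le_right _ _).trans (min_le_right _ _)
    simp only [mem_Icc] at hx hy
    refine ⟨?_, hball ?_⟩
    · rw [closure_Ω]
      exact ⟨⟨hx.1, by dsimp only; linarith⟩, ⟨by dsimp only; linarith, hy.2⟩⟩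
    · rw [Metric.mem_ball, Prod.dist_eq, max_lt_iff, Real.dist_eq, Real.dist_eq, abs_lt, abs_lt]
      dsimp only [corner]
      refine ⟨⟨?_, ?_⟩, ⟨?_, ?_⟩⟩ <;> linarith

variable {G} {w w' : ℝ × ℝ → ℝ}

theorem cornerDeriv_eq_pd (m n : ℕ) : G.cornerDeriv w m n =
    (pd G.D (1, 0))^[m] ((pd G.D (0, 1))^[n] w) G.corner := rfl

theorem cornerDeriv_congr (h : EqOn w w' G.D) (m n : ℕ) :
    G.cornerDeriv w m n = G.cornerDeriv w' m n :=
  pd_iterate_congr m (pd_iterate_congr n h) G.corner_mem_D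

theorem cornerDeriv_sum {ι : Type*} (s : Finset ι) (c : ι → ℝ) (W : ι → ℝ × ℝ → ℝ) (m n : ℕ)
    (hW : ∀ i ∈ s, ContDiffOn ℝ ((m + n : ℕ) : WithTop ℕ∞) (W i) G.D) :
    G.cornerDeriv (fun p => ∑ i ∈ s, c i * W i p) m n = ∑ i ∈ s, c i * G.cornerDeriv (W i) m n := by
  simp only [cornerDeriv_eq_pd]
  rw [pd_iterate_congr m (pd_iterate_sum G.uniqueDiffOn_D s c n W fun i hi =>
      (hW i hi).of_le (by norm_cast; omega)) G.corner_mem_D,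
    pd_iterate_sum G.uniqueDiffOn_D s c m _ (fun i hi =>
      contDiffOn_pd_iterate G.uniqueDiffOn_D n (hW i hi)) G.corner_mem_D]

theorem cornerDeriv_mul (m n : ℕ) (hw : ContDiffOn ℝ ((m + n : ℕ) : WithTop ℕ∞) w G.D)
    (hw' : ContDiffOn ℝ ((m + n : ℕ) : WithTop ℕ∞) w' G.D) :
    G.cornerDeriv (fun p => w p * w' p) m n =
      ∑ q ∈ Finset.HasAntidiagonal.antidiagonal n, ∑ p ∈ Finset.HasAntidiagonal.antidiagonal m,
        ((n.choose q.1 : ℝ) * (m.choose p.1 : ℝ)) *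
          (G.cornerDeriv w p.1 q.1 * G.cornerDeriv w' p.2 q.2) := by
  have hs : ∀ {f : ℝ × ℝ → ℝ}, ContDiffOn ℝ ((m + n : ℕ) : WithTop ℕ∞) f G.D → ∀ j ≤ n,
      ContDiffOn ℝ (m : WithTop ℕ∞) ((pd G.D (0, 1))^[j] f) G.D := fun hf j hj =>
    contDiffOn_pd_iterate G.uniqueDiffOn_D j (hf.of_le (by norm_cast; omega))
  simp only [cornerDeriv_eq_pd]
  rw [pd_iterate_congr m (pd_iterate_mul G.uniqueDiffOn_D n (hw.of_le (by norm_cast; omega))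
    (hw'.of_le (by norm_cast; omega))) G.corner_mem_D]
  rw [pd_iterate_sum G.uniqueDiffOn_D (Finset.HasAntidiagonal.antidiagonal n)
    (fun q => (n.choose q.1 : ℝ)) m
    (fun q p => (pd G.D (0, 1))^[q.1] w p * (pd G.D (0, 1))^[q.2] w' p) ?_ G.corner_mem_D]
  · refine Finset.sum_congr rfl fun q hq => ?_
    rw [Finset.HasAntidiagonal.mem_antidiagonal] at hq
    rw [pd_iterate_mul G.uniqueDiffOn_D m (hs hw _ (by omega)) (hs hw' _ (by omega))
      G.corner_mem_D, Finset.mul_sum]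
    exact Finset.sum_congr rfl fun p _ => by ring
  · intro q hq
    rw [Finset.HasAntidiagonal.mem_antidiagonal] at hq
    exact (hs hw _ (by omega)).mul (hs hw' _ (by omega))

/-- `cornerDeriv` takes the `y` derivatives first, so an inner `pdx` has to be commuted past them;
for `pdy` nothing has to move. -/
theorem cornerDeriv_pdx (m n : ℕ) (hw : ContDiffOn ℝ ((n + 1 : ℕ) : WithTop ℕ∞) w G.D) :
    G.cornerDeriv (G.pdx w) m n = G.cornerDeriv w (m + 1) n := by
  simp only [cornerDeriv_eq_pd, Function.iterate_succ_apply]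
  exact pd_iterate_congr m
    (pd_iterate_comm G.uniqueDiffOn_D G.D_subset_closure_interior n hw) G.corner_mem_D

theorem cornerDeriv_pdy (m n : ℕ) :
    G.cornerDeriv (G.pdy w) m n = G.cornerDeriv w m (n + 1) := rfl

/-- The identity is given only on the open side and off the interface, which may meet this side away
from the corner. On a short segment ending at the corner it extends to the endpoint by continuity;
near `l₄` that segment coincides with the whole side, and along it one differentiates `w` on a line.
-/
theorem leftDeriv_eq_cornerDeriv {g : ℝ → ℝ} (n : ℕ)
    (hw : ContDiffOn ℝ (n : WithTop ℕ∞) w G.D) (hg : ContinuousOn g (Icc G.l₃ G.l₄))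
    (h : ∀ p ∈ G.Γ₁ ∩ G.D, w p = g p.2) : G.leftDeriv g n = G.cornerDeriv w 0 n := by
  obtain ⟨δ, hδ, -, hδ₂, hsub⟩ := G.exists_square_subset_D
  have hlt : G.l₄ - δ < G.l₄ := by linarith
  have hmaps : ∀ t ∈ Icc (G.l₄ - δ) G.l₄, ((G.l₁, 0) : ℝ × ℝ) + t • ((0 : ℝ), (1 : ℝ)) ∈ G.D := by
    intro t ht
    refine hsub ⟨?_, ?_⟩
    · simp [hδ.le]
    · simpa using ht
  have hcont : ContinuousOn (fun t : ℝ => w ((G.l₁, 0) + t • ((0 : ℝ), (1 : ℝ))))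
      (Icc (G.l₄ - δ) G.l₄) :=
    hw.continuousOn.comp (by fun_prop) hmaps
  have heq : EqOn g (fun t : ℝ => w ((G.l₁, 0) + t • ((0 : ℝ), (1 : ℝ)))) (Icc (G.l₄ - δ) G.l₄) := by
    refine EqOn.of_subset_closure (s := Ioo (G.l₄ - δ) G.l₄) (fun t ht => ?_)
      (hg.mono (Icc_subset_Icc_left hδ₂.le)) hcont Ioo_subset_Icc_self
      (closure_Ioo hlt.ne).ge
    have := h ((G.l₁, 0) + t • ((0 : ℝ), (1 : ℝ))) ⟨⟨by simp, by simp; constructor <;> linarith [ht.1, ht.2]⟩,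
      hmaps t (Ioo_subset_Icc_self ht)⟩
    rw [this]; simp
  have hset : (Icc G.l₃ G.l₄ : Set ℝ) =ᶠ[𝓝 G.l₄] Icc (G.l₄ - δ) G.l₄ := by
    filter_upwards [Ioi_mem_nhds hlt] with t ht
    refine propext ⟨fun h => ⟨(le_of_lt ht), h.2⟩, fun h => ⟨by linarith [h.1], h.2⟩⟩
  have hmem : G.l₄ ∈ Icc (G.l₄ - δ) G.l₄ := ⟨hlt.le, le_rfl⟩
  have hlhs : G.leftDeriv g n = iteratedDerivWithin n g (Icc (G.l₄ - δ) G.l₄) G.l₄ := by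
    simp only [leftDeriv, iteratedDerivWithin]
    rw [iteratedFDerivWithin_congr_set hset]
  rw [hlhs, iteratedDerivWithin_congr heq hmem,
    iteratedDerivWithin_line _ (uniqueDiffOn_Icc hlt) hmaps G.uniqueDiffOn_D n hw _ hmem]
  simp [cornerDeriv_eq_pd, corner]

theorem topDeriv_eq_cornerDeriv {g : ℝ → ℝ} (n : ℕ)
    (hw : ContDiffOn ℝ (n : WithTop ℕ∞) w G.D) (hg : ContinuousOn g (Icc G.l₁ G.l₂))
    (h : ∀ p ∈ G.Γ₄ ∩ G.D, w p = g p.1) : G.topDeriv g n = G.cornerDeriv w n 0 := by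
  obtain ⟨δ, hδ, hδ₁, -, hsub⟩ := G.exists_square_subset_D
  have hlt : G.l₁ < G.l₁ + δ := by linarith
  have hmaps : ∀ t ∈ Icc G.l₁ (G.l₁ + δ), ((0, G.l₄) : ℝ × ℝ) + t • ((1 : ℝ), (0 : ℝ)) ∈ G.D := by
    intro t ht
    refine hsub ⟨?_, ?_⟩
    · simpa using ht
    · simp [hδ.le]
  have hcont : ContinuousOn (fun t : ℝ => w ((0, G.l₄) + t • ((1 : ℝ), (0 : ℝ))))
      (Icc G.l₁ (G.l₁ + δ)) :=
    hw.continuousOn.comp (by fun_prop) hmaps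
  have heq : EqOn g (fun t : ℝ => w ((0, G.l₄) + t • ((1 : ℝ), (0 : ℝ)))) (Icc G.l₁ (G.l₁ + δ)) := by
    refine EqOn.of_subset_closure (s := Ioo G.l₁ (G.l₁ + δ)) (fun t ht => ?_)
      (hg.mono (Icc_subset_Icc_right hδ₁.le)) hcont Ioo_subset_Icc_self
      (closure_Ioo hlt.ne).ge
    have := h ((0, G.l₄) + t • ((1 : ℝ), (0 : ℝ))) ⟨⟨by simp; constructor <;> linarith [ht.1, ht.2], by simp⟩,
      hmaps t (Ioo_subset_Icc_self ht)⟩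
    rw [this]; simp
  have hset : (Icc G.l₁ G.l₂ : Set ℝ) =ᶠ[𝓝 G.l₁] Icc G.l₁ (G.l₁ + δ) := by
    filter_upwards [Iio_mem_nhds hlt] with t ht
    refine propext ⟨fun h => ⟨h.1, (le_of_lt ht)⟩, fun h => ⟨h.1, by linarith [h.2]⟩⟩
  have hmem : G.l₁ ∈ Icc G.l₁ (G.l₁ + δ) := ⟨le_rfl, hlt.le⟩
  have hlhs : G.topDeriv g n = iteratedDerivWithin n g (Icc G.l₁ (G.l₁ + δ)) G.l₁ := by
    simp only [topDeriv, iteratedDerivWithin]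
    rw [iteratedFDerivWithin_congr_set hset]
  rw [hlhs, iteratedDerivWithin_congr heq hmem,
    iteratedDerivWithin_line _ (uniqueDiffOn_Icc hlt) hmaps G.uniqueDiffOn_D n hw _ hmem]
  simp [cornerDeriv_eq_pd, corner]

theorem gridSize_pos {N₁ : ℕ} (h : 0 < N₁) : 0 < G.gridSize N₁ :=
  div_pos (sub_pos.2 G.l₁_lt_l₂) (by exact_mod_cast h)

theorem tendsto_gridSize : Tendsto (fun N₁ => G.gridSize N₁) atTop (𝓝 0) :=
  tendsto_const_div_atTop_nhds_zero_nat _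

theorem gridPoint_eq {N₁ : ℕ} (h : 0 < N₁) (k j : Fin 2) : G.gridPoint N₁ k j =
    G.corner + G.gridSize N₁ • (((k : ℕ) : ℝ), -((j : ℕ) : ℝ)) := by
  have h0 : (N₁ : ℝ) ≠ 0 := by exact_mod_cast h.ne'
  have h1 : (G.N₀ * N₁ : ℝ) * G.gridSize N₁ = G.l₄ - G.l₃ := by
    rw [G.sides, gridSize]; field_simp
  ext
  · simp [gridPoint, corner, mul_comm]
  · simp only [gridPoint, corner, Prod.snd_add, Prod.smul_snd, smul_eq_mul]
    linear_combination h1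

/-- Taylor's formula at the corner, on the points of the four-point stencil. -/
theorem taylor_gridPoint (d : ℕ) (hw : ContDiffOn ℝ ((d + 1 : ℕ) : WithTop ℕ∞) w G.D)
    (k j : Fin 2) :
    (fun N₁ : ℕ => w (G.gridPoint N₁ k j) - ∑ i ∈ Finset.range (d + 1), G.gridSize N₁ ^ i *
      ∑ p ∈ Finset.HasAntidiagonal.antidiagonal i, ((k : ℕ) : ℝ) ^ p.1 * (-((j : ℕ) : ℝ)) ^ p.2 /
        (p.1.factorial * p.2.factorial) * G.cornerDeriv w p.1 p.2)
      =O[atTop] (fun N₁ : ℕ => G.gridSize N₁ ^ (d + 1)) := by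
  obtain ⟨δ, hδ, hδ₁, hδ₂, hsub⟩ := G.exists_square_subset_D
  set v : ℝ × ℝ := (((k : ℕ) : ℝ), -((j : ℕ) : ℝ)) with hv
  have hk : (0 : ℝ) ≤ ((k : ℕ) : ℝ) ∧ ((k : ℕ) : ℝ) ≤ 1 :=
    ⟨by positivity, by exact_mod_cast Nat.lt_succ_iff.1 k.2⟩
  have hj : (0 : ℝ) ≤ ((j : ℕ) : ℝ) ∧ ((j : ℕ) : ℝ) ≤ 1 :=
    ⟨by positivity, by exact_mod_cast Nat.lt_succ_iff.1 j.2⟩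
  -- Taylor's formula is applied in one variable, along the ray from the corner in the direction
  -- `(k, -j)`. Its components are at most one in absolute value, so the ray stays in the square up
  -- to `t = δ`.
  have hmaps : ∀ t ∈ Icc 0 δ, G.corner + t • v ∈ G.D := by
    intro t ht
    refine hsub ⟨⟨?_, ?_⟩, ⟨?_, ?_⟩⟩ <;> simp only [corner, hv, Prod.fst_add, Prod.snd_add,
      Prod.smul_fst, Prod.smul_snd, smul_eq_mul] <;> nlinarith [ht.1, ht.2, hk.1, hk.2, hj.1, hj.2]
  have hcd : ContDiffOn ℝ ((d : WithTop ℕ∞) + 1) (fun t : ℝ => w (G.corner + t • v)) (Icc 0 δ) := by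
    refine ContDiffOn.comp (t := G.D) (by exact_mod_cast hw) ?_ hmaps
    exact (contDiff_const.add (contDiff_id.smul contDiff_const)).contDiffOn
  obtain ⟨C, hC⟩ := exists_taylor_mean_remainder_bound hδ.le hcd
  refine IsBigO.of_bound C ?_
  have hev : ∀ᶠ N₁ : ℕ in atTop, G.gridSize N₁ < δ :=
    (G.tendsto_gridSize).eventually (gt_mem_nhds hδ)
  filter_upwards [hev, eventually_gt_atTop 0] with N₁ h1 h2
  have hpos := G.gridSize_pos h2
  have := hC (G.gridSize N₁) ⟨hpos.le, h1.le⟩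
  rw [sub_zero] at this
  rw [Real.norm_of_nonneg (by positivity : (0 : ℝ) ≤ G.gridSize N₁ ^ (d + 1))]
  refine le_trans (le_of_eq ?_) this
  rw [gridPoint_eq h2, taylor_within_apply]
  congr 2
  refine Finset.sum_congr rfl fun i hi => ?_
  rw [Finset.mem_range] at hi
  have hwi : ContDiffOn ℝ (i : WithTop ℕ∞) w G.D := hw.of_le (by norm_cast; omega)
  rw [iteratedDerivWithin_line _ (uniqueDiffOn_Icc hδ) hmaps G.uniqueDiffOn_D i hwi 0
    ⟨le_rfl, hδ.le⟩, zero_smul, add_zero,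
    pd_iterate_eq_sum G.uniqueDiffOn_D G.D_subset_closure_interior i hwi G.corner_mem_D]
  simp only [sub_zero, smul_eq_mul, Finset.mul_sum]
  refine Finset.sum_congr rfl fun p hp => ?_
  rw [Finset.HasAntidiagonal.mem_antidiagonal] at hp
  -- The binomial coefficient over `i!` becomes `1 / (p.1! p.2!)`.
  rw [← hp, Nat.choose_symm_add, Nat.add_choose, Nat.cast_div (Nat.factorial_mul_factorial_dvd_factorial_add _ _)
    (by positivity), cornerDeriv_eq_pd]
  have : ((p.1 + p.2).factorial : ℝ) ≠ 0 := by positivity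
  push_cast
  field_simp
  simp only [hv]
  ring

end InterfaceDomain

end CornerFD

/-! ### Formal jets: elimination down to four even derivatives -/

namespace CornerFD

section Formal

variable {Q R : Type*} [AddCommGroup Q] [Module ℝ Q] [AddCommGroup R] [Module ℝ R]

/-- The jet of the product of a function with jet `a` and one with jet `U`. -/
def jetMul (a : ℕ → ℕ → ℝ) (U : ℕ → ℕ → Q) (m n : ℕ) : Q :=
  ∑ q ∈ Finset.HasAntidiagonal.antidiagonal n, ∑ p ∈ Finset.HasAntidiagonal.antidiagonal m,
    ((n.choose q.1 : ℝ) * (m.choose p.1 : ℝ) * a p.1 q.1) • U p.2 q.2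

theorem map_jetMul (φ : Q →ₗ[ℝ] R) (a : ℕ → ℕ → ℝ) (U : ℕ → ℕ → Q) (m n : ℕ) :
    φ (jetMul a U m n) = jetMul a (fun i j => φ (U i j)) m n := by
  simp [jetMul, map_sum]

/-- A derivative that falls on `a` leaves fewer than `m + n` for the other factor, so only the term
with `a` undifferentiated survives. -/
theorem jetMul_eq_smul {a : ℕ → ℕ → ℝ} {V : ℕ → ℕ → Q} {m n : ℕ}
    (hV : ∀ i j, i + j < m + n → V i j = 0) : jetMul a V m n = a 0 0 • V m n := by
  rw [jetMul, Finset.sum_eq_single (0, n), Finset.sum_eq_single (0, m)]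
  · simp
  · rintro ⟨i, j⟩ hp hne
    rw [Finset.HasAntidiagonal.mem_antidiagonal] at hp
    have : j < m := by
      rcases Nat.eq_zero_or_pos i with h | h
      · subst h; simp at hp; simp [hp] at hne
      · dsimp only at hp; omega
    rw [hV _ _ (by dsimp only; omega), smul_zero]
  · simp
  · rintro ⟨i, j⟩ hq hne
    rw [Finset.HasAntidiagonal.mem_antidiagonal] at hq
    have : j < n := by
      rcases Nat.eq_zero_or_pos i with h | h
      · subst h; simp at hq; simp [hq] at hne
      · dsimp only at hq; omega
    refine Finset.sum_eq_zero fun p hp => ?_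
    rw [Finset.HasAntidiagonal.mem_antidiagonal] at hp
    rw [hV _ _ (by dsimp only; omega), smul_zero]
  · simp

/-- The relations between the derivatives at the corner, up to order six, of a solution with
vanishing data. -/
structure IsHomogeneousJet (J : CornerJet) (U : ℕ → ℕ → Q) : Prop where
  pde : ∀ m n, m + n ≤ 4 → jetMul J.a (fun i j => U (i + 1) j) (m + 1) n
    + jetMul J.a (fun i j => U i (j + 1)) m (n + 1) = 0
  left : ∀ n ≤ 5, -U 1 n + ∑ q ∈ Finset.HasAntidiagonal.antidiagonal n,
    ((n.choose q.1 : ℝ) * J.α q.1) • U 0 q.2 = 0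
  top : ∀ m ≤ 5, U m 1 + ∑ p ∈ Finset.HasAntidiagonal.antidiagonal m,
    ((m.choose p.1 : ℝ) * J.β p.1) • U p.2 0 = 0

theorem IsHomogeneousJet.map {J : CornerJet} {U : ℕ → ℕ → Q} (hU : IsHomogeneousJet J U)
    (φ : Q →ₗ[ℝ] R) : IsHomogeneousJet J (fun i j => φ (U i j)) where
  pde m n h := by
    simpa [map_jetMul] using congrArg φ (hU.pde m n h)
  left n h := by simpa [map_sum] using congrArg φ (hU.left n h)
  top m h := by simpa [map_sum] using congrArg φ (hU.top m h)

/-- The derivatives at the origin of the even harmonic polynomial `Re (x + i y) ^ (m + n)`, up to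
a common factor. -/
def evenSign (m n : ℕ) : ℝ := if Even m ∧ Even n then (-1) ^ (n / 2) else 0

/-- Once the lower orders vanish, the variable coefficients enter only through `a 0 0` and the Robin
terms drop out: what remains is the homogeneous Laplace equation with Neumann conditions. The bound
six is how far four derivatives of the equation and five of the boundary conditions reach. -/
theorem IsHomogeneousJet.leading {J : CornerJet} (hJ : J.a 0 0 ≠ 0) {V : ℕ → ℕ → Q}
    (hV : IsHomogeneousJet J V) {d : ℕ} (hd : d ≤ 6) (h0 : ∀ i j, i + j < d → V i j = 0)
    (m n : ℕ) (hmn : m + n = d) : V m n = evenSign m n • V d 0 := by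
  have lap : ∀ m n, m + n + 2 = d → V m (n + 2) = -V (m + 2) n := by
    intro m n h
    have h1 := hV.pde m n (by omega)
    rw [jetMul_eq_smul (fun i j hij => h0 _ _ (by omega)),
      jetMul_eq_smul (fun i j hij => h0 _ _ (by omega)), ← smul_add, smul_eq_zero] at h1
    exact eq_neg_of_add_eq_zero_right (h1.resolve_left hJ)
  have top : ∀ m, m + 1 = d → V m 1 = 0 := by
    intro m h
    have h1 := hV.top m (by omega)
    rwa [Finset.sum_eq_zero (fun p hp => ?_), add_zero] at h1
    rw [Finset.HasAntidiagonal.mem_antidiagonal] at hp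
    rw [h0 _ _ (by omega), smul_zero]
  have left : ∀ n, n + 1 = d → V 1 n = 0 := by
    intro n h
    have h1 := hV.left n (by omega)
    rwa [Finset.sum_eq_zero (fun p hp => ?_), add_zero, neg_eq_zero] at h1
    rw [Finset.HasAntidiagonal.mem_antidiagonal] at hp
    rw [h0 _ _ (by omega), smul_zero]
  have even : ∀ j m, m + 2 * j = d → V m (2 * j) = ((-1 : ℝ) ^ j) • V d 0 := by
    intro j
    induction j with
    | zero => intro m h; simp at h; simp [h]
    | succ j ih =>
      intro m h
      rw [show 2 * (j + 1) = 2 * j + 2 by ring, lap m (2 * j) (by omega), ih (m + 2) (by omega),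
        pow_succ]
      simp
  have odd : ∀ j m, m + 2 * j + 1 = d → V m (2 * j + 1) = 0 := by
    intro j
    induction j with
    | zero => intro m h; exact top m (by omega)
    | succ j ih =>
      intro m h
      rw [show 2 * (j + 1) + 1 = (2 * j + 1) + 2 by ring, lap m (2 * j + 1) (by omega),
        ih (m + 2) (by omega), neg_zero]
  rcases Nat.even_or_odd' n with ⟨j, rfl | rfl⟩
  · rw [even j m hmn]
    by_cases hm : Even m
    · simp [evenSign, hm]
    -- For odd `m` the alternating relation ties `V d 0` to `V 1 (d - 1)`, which the left condition
    -- annihilates.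
    · have hd' : V d 0 = 0 := by
        rw [Nat.not_even_iff_odd] at hm
        obtain ⟨i, rfl⟩ := hm
        have h1 := even (i + j) 1 (by omega)
        rw [left _ (by omega)] at h1
        exact (smul_eq_zero.1 h1.symm).resolve_left (by simp)
      simp [hd']
  · rw [odd j m (by omega)]
    have : ¬ Even (2 * j + 1) := by simp
    simp [evenSign, this]

/-- The span of the even pure derivatives of order less than `d`. -/
def lowerSpan (U : ℕ → ℕ → Q) (d : ℕ) : Submodule ℝ Q :=
  Submodule.span ℝ ((fun k => U (2 * k) 0) '' ((Finset.range 4).filter (fun k => 2 * k < d)))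

/-- By induction the derivatives of order below `d` lie in the span, so they vanish in the quotient
by it. The image of the jet there is again homogeneous, and `leading` applies. -/
theorem IsHomogeneousJet.sub_mem_lowerSpan {J : CornerJet} (hJ : J.a 0 0 ≠ 0) {U : ℕ → ℕ → Q}
    (hU : IsHomogeneousJet J U) (d : ℕ) : d ≤ 6 → ∀ m n, m + n = d →
      U m n - evenSign m n • U d 0 ∈ lowerSpan U d := by
  induction d using Nat.strong_induction_on with
  | _ d ih =>
    intro hd m n hmn
    have hlow : ∀ i j, i + j < d → U i j ∈ lowerSpan U d := by
      intro i j hij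
      have h1 := ih (i + j) hij (by omega) i j rfl
      have h2 : U i j - evenSign i j • U (i + j) 0 ∈ lowerSpan U d := by
        refine Submodule.span_mono (image_mono ?_) h1
        intro k hk
        simp only [Finset.coe_filter, mem_ofPred_eq] at hk ⊢
        exact ⟨hk.1, by omega⟩
      have h3 : evenSign i j • U (i + j) 0 ∈ lowerSpan U d := by
        by_cases he : Even i ∧ Even j
        · obtain ⟨k, hk⟩ := he.1.add he.2
          refine Submodule.smul_mem _ _ (Submodule.subset_span ⟨k, ?_, ?_⟩)
          · simp only [Finset.coe_filter, Finset.mem_range, mem_ofPred_eq]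
            omega
          · simp only [hk, two_mul]
        · simp [evenSign, he]
      simpa using Submodule.add_mem _ h2 h3
    have h := (hU.map (lowerSpan U d).mkQ).leading hJ hd
      (fun i j hij => by simpa using hlow i j hij) m n hmn
    rw [← map_smul, ← sub_eq_zero, ← map_sub] at h
    rwa [Submodule.mkQ_apply, Submodule.Quotient.mk_eq_zero] at h

/-- Elimination: all derivatives of order at most six are combinations of the even pure ones, with
the leading coefficients of the Neumann problem. -/
theorem IsHomogeneousJet.exists_elimination {J : CornerJet} (hJ : J.a 0 0 ≠ 0) {U : ℕ → ℕ → Q}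
    (hU : IsHomogeneousJet J U) : ∃ A : ℕ → ℕ → ℕ → ℝ, ∀ m n, m + n ≤ 6 →
      U m n = ∑ k ∈ Finset.range 4, A m n k • U (2 * k) 0 ∧
      ∀ k, m + n ≤ 2 * k → A m n k = if m + n = 2 * k then evenSign m n else 0 := by
  have h : ∀ m n, ∃ c : ℕ → ℝ, m + n ≤ 6 →
      ∑ k ∈ (Finset.range 4).filter (fun k => 2 * k < m + n), c k • U (2 * k) 0
        = U m n - evenSign m n • U (m + n) 0 := by
    intro m n
    by_cases hmn : m + n ≤ 6
    · obtain ⟨c, hc⟩ := Submodule.mem_span_image_finset_iff_exists_fun' ℝ |>.1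
        (hU.sub_mem_lowerSpan hJ (m + n) hmn m n rfl)
      exact ⟨c, fun _ => hc⟩
    · exact ⟨0, fun h => absurd h hmn⟩
  choose c hc using h
  refine ⟨fun m n k => if 2 * k < m + n then c m n k else if m + n = 2 * k then evenSign m n else 0,
    fun m n hmn => ⟨?_, fun k hk => by dsimp only; rw [if_neg (by omega)]⟩⟩
  have h1 := hc m n hmn
  rw [Finset.sum_filter, eq_sub_iff_add_eq] at h1
  rw [← h1]
  have h2 : evenSign m n • U (m + n) 0
      = ∑ k ∈ Finset.range 4, (if m + n = 2 * k then evenSign m n else 0) • U (2 * k) 0 := by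
    by_cases he : Even m ∧ Even n
    · obtain ⟨k, hk⟩ := he.1.add he.2
      rw [Finset.sum_eq_single k]
      · rw [if_pos (by omega), hk, two_mul]
      · intro b _ hb
        rw [if_neg (by omega), zero_smul]
      · intro hk'
        simp only [Finset.mem_range] at hk'
        omega
    · simp [evenSign, he]
  rw [h2, ← Finset.sum_add_distrib]
  refine Finset.sum_congr rfl fun k _ => ?_
  dsimp only
  split_ifs <;> first | omega | simp

end Formal

/-! ### Stencil weights by a cross product -/

section Stencil

open Polynomial

theorem X_pow_dvd_sub_modByMonic (P : ℝ[X]) (n : ℕ) : X ^ n ∣ P %ₘ X ^ n - P :=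
  ⟨-(P /ₘ X ^ n), by linear_combination (modByMonic_add_div P (X ^ n : ℝ[X]))⟩

/-- Stencil coefficients annihilating, to seventh order, four functions with the leading
behaviour of the even harmonic polynomials of degrees `0`, `2`, `4`, `6`. -/
theorem exists_stencil (q : Fin 2 → Fin 2 → ℕ → ℝ[X])
    (hv : ∀ k j i, ∀ e < 2 * i, (q k j i).coeff e = 0)
    (hc₀ : q 0 0 0 = 1) (hc : ∀ i < 4, 0 < i → q 0 0 i = 0)
    (h₀ : ∀ k j, (q k j 0).coeff 0 = 1)
    (h₁ : (q 1 0 1).coeff 2 = 1 / 2 ∧ (q 0 1 1).coeff 2 = -1 / 2 ∧ (q 1 1 1).coeff 2 = 0)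
    (h₂ : (q 1 0 2).coeff 4 = 1 / 24 ∧ (q 0 1 2).coeff 4 = 1 / 24 ∧ (q 1 1 2).coeff 4 = -1 / 6)
    (h₃ : (q 1 0 3).coeff 6 = 1 / 720 ∧ (q 0 1 3).coeff 6 = -1 / 720 ∧ (q 1 1 3).coeff 6 = 0) :
    ∃ C : Fin 2 → Fin 2 → ℝ[X], (∀ k j, (C k j).natDegree ≤ 6) ∧ (∀ k j, (C k j).eval 0 ≠ 0) ∧
      ∀ i < 4, X ^ 7 ∣ ∑ k, ∑ j, C k j * q k j i := by
  have hdvd : ∀ k j i, ∃ P : ℝ[X], q k j i = X ^ (2 * i) * P := fun k j i =>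
    X_pow_dvd_iff.2 (hv k j i)
  choose P hP using hdvd
  have hP0 : ∀ k j i, (P k j i).coeff 0 = (q k j i).coeff (2 * i) := fun k j i => by
    rw [hP k j i]
    simpa using (coeff_X_pow_mul (P k j i) (2 * i) 0).symm
  -- The cross product of the rows `i = 1` and `i = 2` over the points `(1,0)`, `(0,-1)`, `(1,-1)`,
  -- after removal of the common powers of `X`.
  set c₁ := P 0 1 1 * P 1 1 2 - P 1 1 1 * P 0 1 2 with hc₁
  set c₂ := P 1 1 1 * P 1 0 2 - P 1 0 1 * P 1 1 2 with hc₂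
  set c₃ := P 1 0 1 * P 0 1 2 - P 0 1 1 * P 1 0 2 with hc₃
  set c₀ := -(c₁ * q 1 0 0 + c₂ * q 0 1 0 + c₃ * q 1 1 0) with hc₀'
  have e₁ : c₁.coeff 0 = 1 / 12 := by
    simp only [hc₁, coeff_sub, mul_coeff_zero, hP0, h₁, h₂]; norm_num
  have e₂ : c₂.coeff 0 = 1 / 12 := by
    simp only [hc₂, coeff_sub, mul_coeff_zero, hP0, h₁, h₂]; norm_num
  have e₃ : c₃.coeff 0 = 1 / 24 := by
    simp only [hc₃, coeff_sub, mul_coeff_zero, hP0, h₁, h₂]; norm_num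
  have e₀ : c₀.coeff 0 = -5 / 24 := by
    simp only [hc₀', coeff_neg, coeff_add, mul_coeff_zero, h₀, e₁, e₂, e₃]; norm_num
  let C' : Fin 2 → Fin 2 → ℝ[X] := ![![c₀, c₂], ![c₁, c₃]]
  -- Truncation modulo `X ^ 7` bounds the degree by six and affects neither the constant terms nor
  -- divisibility by `X ^ 7`.
  have hmod : ∀ R : ℝ[X], (R %ₘ X ^ 7).coeff 0 = R.coeff 0 := fun R => by
    have := X_pow_dvd_iff.1 (X_pow_dvd_sub_modByMonic R 7) 0 (by norm_num)
    rw [coeff_sub] at this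
    linarith
  refine ⟨fun k j => C' k j %ₘ X ^ 7, fun k j => ?_, fun k j => ?_, fun i hi => ?_⟩
  · have := natDegree_modByMonic_lt (C' k j) (monic_X_pow 7 : (X ^ 7 : ℝ[X]).Monic)
      (by intro h; simpa using congrArg natDegree h)
    rw [natDegree_X_pow] at this
    exact Nat.lt_succ_iff.1 this
  · rw [← coeff_zero_eq_eval_zero, hmod]
    fin_cases k <;> fin_cases j <;> simp [C', e₀, e₁, e₂, e₃]
  · have h1 : ∑ k, ∑ j, C' k j %ₘ X ^ 7 * q k j i =
        ∑ k, ∑ j, C' k j * q k j i + ∑ k, ∑ j, (C' k j %ₘ X ^ 7 - C' k j) * q k j i := by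
      simp only [← Finset.sum_add_distrib]
      exact Finset.sum_congr rfl fun k _ => Finset.sum_congr rfl fun j _ => by ring
    rw [h1]
    refine dvd_add ?_ (Finset.dvd_sum fun k _ => Finset.dvd_sum fun j _ =>
      (X_pow_dvd_sub_modByMonic _ 7).mul_right _)
    have h2 : ∑ k, ∑ j, C' k j * q k j i =
        c₀ * q 0 0 i + c₂ * q 0 1 i + (c₁ * q 1 0 i + c₃ * q 1 1 i) := by
      simp [Fin.sum_univ_two, C']
    rw [h2]
    interval_cases i
    · rw [hc₀, hc₀']
      convert dvd_zero _ using 1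
      ring
    · rw [hc 1 (by norm_num) (by norm_num), hP 0 1, hP 1 0, hP 1 1, hc₁, hc₂, hc₃]
      convert dvd_zero _ using 1
      ring
    · rw [hc 2 (by norm_num) (by norm_num), hP 0 1, hP 1 0, hP 1 1, hc₁, hc₂, hc₃]
      convert dvd_zero _ using 1
      ring
    · rw [hc 3 (by norm_num) (by norm_num), hP 0 1, hP 1 0, hP 1 1]
      -- The decisive cancellation: the constant term is `(1/12)(-1/720) + (1/12)(1/720) + (1/24) *
      -- 0`. It turns `X ^ 6` into `X ^ 7`.
      have h4 : X ∣ c₂ * P 0 1 3 + c₁ * P 1 0 3 + c₃ * P 1 1 3 := by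
        rw [X_dvd_iff]
        simp only [coeff_add, mul_coeff_zero, hP0, h₃, e₁, e₂, e₃]
        norm_num
      obtain ⟨R, hR⟩ := h4
      exact ⟨R, by linear_combination (X : ℝ[X]) ^ 6 * hR⟩

end Stencil

end CornerFD

/-! ### Formal solutions modulo data, and the scheme they give -/

namespace CornerFD

section FormalScheme

open Polynomial

/-- The corner derivatives of a solution and of its data, constrained by the derivatives of the
differential equation up to order four and of the Robin conditions up to order five. -/
structure CornerJet.FormalSolution (J : CornerJet) where
  u : ℕ → ℕ → ℝ
  f : ℕ → ℕ → ℝ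
  g₁ : ℕ → ℝ
  g₄ : ℕ → ℝ
  pde : ∀ m n, m + n ≤ 4 → jetMul J.a (fun i j => u (i + 1) j) (m + 1) n
    + jetMul J.a (fun i j => u i (j + 1)) m (n + 1) = -f m n
  left : ∀ n ≤ 5, -u 1 n + ∑ q ∈ Finset.HasAntidiagonal.antidiagonal n,
    ((n.choose q.1 : ℝ) * J.α q.1) • u 0 q.2 = g₁ n
  top : ∀ m ≤ 5, u m 1 + ∑ p ∈ Finset.HasAntidiagonal.antidiagonal m,
    ((m.choose p.1 : ℝ) * J.β p.1) • u p.2 0 = g₄ m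

/-- The linear combination of the data `f^{(m,n)}`, `m + n ≤ 4`, `g₁^{(n)}`, `g₄^{(n)}`, `n ≤ 5`,
with given coefficients, as a functional of the formal solution. -/
def dataFunctional (J : CornerJet) :
    ((ℕ → ℕ → ℝ) × (ℕ → ℝ) × (ℕ → ℝ)) →ₗ[ℝ] (J.FormalSolution → ℝ) where
  toFun c := fun s => (∑ d ∈ Finset.range 5, ∑ q ∈ Finset.HasAntidiagonal.antidiagonal d,
      s.f q.1 q.2 * c.1 q.1 q.2)
    + ∑ n ∈ Finset.range 6, s.g₁ n * c.2.1 n + ∑ n ∈ Finset.range 6, s.g₄ n * c.2.2 n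
  map_add' c c' := by
    funext s
    simp only [Prod.fst_add, Prod.snd_add, Pi.add_apply, mul_add, Finset.sum_add_distrib]
    ring
  map_smul' r c := by
    funext s
    simp only [Prod.smul_fst, Prod.smul_snd, Pi.smul_apply, smul_eq_mul, RingHom.id_apply, mul_add,
      Finset.mul_sum, mul_left_comm]

variable {J : CornerJet}

theorem f_mem_range_dataFunctional {m n : ℕ} (h : m + n ≤ 4) :
    (fun s : J.FormalSolution => s.f m n) ∈ LinearMap.range (dataFunctional J) := by
  refine ⟨(fun i j => if (i, j) = (m, n) then 1 else 0, 0, 0), ?_⟩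
  funext s
  simp only [dataFunctional, LinearMap.coe_mk, AddHom.coe_mk]
  rw [Finset.sum_eq_single (m + n), Finset.sum_eq_single (m, n)]
  · simp
  · rintro ⟨i, j⟩ _ hne
    rw [if_neg hne, mul_zero]
  · simp
  · intro d _ hd
    refine Finset.sum_eq_zero fun q hq => ?_
    rw [Finset.HasAntidiagonal.mem_antidiagonal] at hq
    rw [if_neg, mul_zero]
    rintro ⟨⟩
    exact hd hq.symm
  · intro h'
    simp only [Finset.mem_range] at h'
    omega

theorem g₁_mem_range_dataFunctional {n : ℕ} (h : n ≤ 5) :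
    (fun s : J.FormalSolution => s.g₁ n) ∈ LinearMap.range (dataFunctional J) := by
  refine ⟨(0, fun i => if i = n then 1 else 0, 0), ?_⟩
  funext s
  simp [dataFunctional, show n < 6 by omega]

theorem g₄_mem_range_dataFunctional {n : ℕ} (h : n ≤ 5) :
    (fun s : J.FormalSolution => s.g₄ n) ∈ LinearMap.range (dataFunctional J) := by
  refine ⟨(0, 0, fun i => if i = n then 1 else 0), ?_⟩
  funext s
  simp [dataFunctional, show n < 6 by omega]

/-- The corner derivatives of the solution modulo those of the data. -/
def jetModData (J : CornerJet) (m n : ℕ) :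
    (J.FormalSolution → ℝ) ⧸ LinearMap.range (dataFunctional J) :=
  Submodule.mkQ _ (fun s : J.FormalSolution => s.u m n)

theorem jetMul_fun_apply {S : Type*} (a : ℕ → ℕ → ℝ) (U : ℕ → ℕ → S → ℝ) (m n : ℕ) (s : S) :
    jetMul a U m n s = jetMul a (fun i j => U i j s) m n :=
  map_jetMul (LinearMap.proj s : (S → ℝ) →ₗ[ℝ] ℝ) a U m n

/-- Each relation has a datum as its right-hand side, and data are zero in the quotient. -/
theorem isHomogeneousJet_jetModData : IsHomogeneousJet J (jetModData J) where
  pde m n h := by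
    simp only [jetModData]
    rw [← map_jetMul _ J.a (fun i j (s : J.FormalSolution) => s.u (i + 1) j),
      ← map_jetMul _ J.a (fun i j (s : J.FormalSolution) => s.u i (j + 1)), ← map_add,
      Submodule.mkQ_apply, Submodule.Quotient.mk_eq_zero]
    convert Submodule.neg_mem _ (f_mem_range_dataFunctional (J := J) h) using 1
    funext s
    simpa [jetMul_fun_apply] using s.pde m n h
  left n h := by
    simp only [jetModData, ← map_smul, ← map_sum, ← map_neg, ← map_add]
    rw [Submodule.mkQ_apply, Submodule.Quotient.mk_eq_zero]
    convert g₁_mem_range_dataFunctional (J := J) h using 1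
    funext s
    simpa using s.left n h
  top n h := by
    simp only [jetModData, ← map_smul, ← map_sum, ← map_add]
    rw [Submodule.mkQ_apply, Submodule.Quotient.mk_eq_zero]
    convert g₄_mem_range_dataFunctional (J := J) h using 1
    funext s
    simpa using s.top n h

/-- The coefficient of `h ^ d` in the Taylor expansion of the function with jet `U` at the stencil
point `(h k, -h j)`. -/
noncomputable def stencilTaylor {Q : Type*} [AddCommGroup Q] [Module ℝ Q] (U : ℕ → ℕ → Q) (k j : Fin 2) (d : ℕ) :
    Q :=
  ∑ p ∈ Finset.HasAntidiagonal.antidiagonal d, (((k : ℕ) : ℝ) ^ p.1 * (-((j : ℕ) : ℝ)) ^ p.2 /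
        (p.1.factorial * p.2.factorial)) • U p.1 p.2

theorem map_stencilTaylor {Q R : Type*} [AddCommGroup Q] [Module ℝ Q] [AddCommGroup R]
    [Module ℝ R] (φ : Q →ₗ[ℝ] R) (U : ℕ → ℕ → Q) (k j : Fin 2) (d : ℕ) :
    φ (stencilTaylor U k j d) = stencilTaylor (fun m n => φ (U m n)) k j d := by
  simp [stencilTaylor, map_sum]

/-- A stencil annihilating a homogeneous jet up to order six. -/
theorem IsHomogeneousJet.exists_stencil {Q : Type*} [AddCommGroup Q] [Module ℝ Q]
    (hJ : J.a 0 0 ≠ 0) {U : ℕ → ℕ → Q} (hU : IsHomogeneousJet J U) :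
    ∃ C : Fin 2 → Fin 2 → ℝ[X], (∀ k j, (C k j).natDegree ≤ 6) ∧ (∀ k j, (C k j).eval 0 ≠ 0) ∧
      ∀ d < 7, ∑ k, ∑ j, ∑ e ∈ Finset.HasAntidiagonal.antidiagonal d,
        (C k j).coeff e.1 • stencilTaylor U k j e.2 = 0 := by
  obtain ⟨A, hA⟩ := hU.exists_elimination hJ
  -- The Taylor polynomial in `h`, at a stencil point, of the function whose jet is the coefficient
  -- of `U (2 * i) 0` in the elimination.
  set q : Fin 2 → Fin 2 → ℕ → ℝ[X] := fun k j i => ∑ d ∈ Finset.range 7,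
    monomial d (stencilTaylor (fun m n => A m n i) k j d) with hq
  have hcoeff : ∀ k j i, ∀ d < 7,
      (q k j i).coeff d = stencilTaylor (fun m n => A m n i) k j d := by
    intro k j i d hd
    simp [hq, coeff_monomial, hd]
  have hcoeff' : ∀ k j i, ∀ d, ¬ d < 7 → (q k j i).coeff d = 0 := by
    intro k j i d hd
    simp [hq, coeff_monomial, hd]
  have hlow : ∀ k j i, ∀ d < 7, d < 2 * i → stencilTaylor (fun m n => A m n i) k j d = 0 := by
    intro k j i d hd hdi
    refine Finset.sum_eq_zero fun p hp => ?_
    rw [Finset.HasAntidiagonal.mem_antidiagonal] at hp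
    dsimp only
    rw [(hA p.1 p.2 (by omega)).2 i (by omega), if_neg (by omega), smul_zero]
  have hlead : ∀ k j i, i < 4 →
      (q k j i).coeff (2 * i) = stencilTaylor evenSign k j (2 * i) := by
    intro k j i hi
    rw [hcoeff _ _ _ _ (by omega)]
    refine Finset.sum_congr rfl fun p hp => ?_
    rw [Finset.HasAntidiagonal.mem_antidiagonal] at hp
    dsimp only
    rw [(hA p.1 p.2 (by omega)).2 i (by omega), if_pos hp]
  have hzero : ∀ i d, 0 < d → stencilTaylor (fun m n => A m n i) 0 0 d = 0 := by
    intro i d hd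
    refine Finset.sum_eq_zero fun p hp => ?_
    rw [Finset.HasAntidiagonal.mem_antidiagonal] at hp
    have : p.1 ≠ 0 ∨ p.2 ≠ 0 := by omega
    rcases this with h | h <;> simp [h]
  have hA0 : ∀ i, A 0 0 i = if i = 0 then 1 else 0 := by
    intro i
    rw [(hA 0 0 (by norm_num)).2 i (by omega)]
    by_cases h : i = 0
    · simp [h, evenSign]
    · rw [if_neg (by omega), if_neg h]
  have h00 : ∀ i, q 0 0 i = if i = 0 then 1 else 0 := by
    intro i
    ext d
    by_cases hd : d < 7
    · rw [hcoeff _ _ _ _ hd]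
      rcases Nat.eq_zero_or_pos d with rfl | hpos
      · simp [stencilTaylor, hA0]
        split_ifs <;> simp
      · rw [hzero i d hpos]
        split_ifs <;> simp [coeff_one, hpos.ne']
    · rw [hcoeff' _ _ _ _ hd]
      split_ifs
      · rw [coeff_one, if_neg (by omega)]
      · simp
  have ev : ∀ k j i, i < 4 → (q k j i).coeff (2 * i) =
      ∑ m ∈ Finset.range (2 * i + 1), ((k : ℕ) : ℝ) ^ m * (-((j : ℕ) : ℝ)) ^ (2 * i - m) /
        (m.factorial * (2 * i - m).factorial) * evenSign m (2 * i - m) := by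
    intro k j i hi
    rw [hlead k j i hi, stencilTaylor, Finset.Nat.sum_antidiagonal_eq_sum_range_succ_mk]
    simp only [smul_eq_mul]
  obtain ⟨C, hC₁, hC₂, hC₃⟩ := CornerFD.exists_stencil q
    (fun k j i e he => by
      by_cases h : e < 7
      · rw [hcoeff _ _ _ _ h, hlow _ _ _ _ h he]
      · exact hcoeff' _ _ _ _ h)
    (by rw [h00]; simp) (fun i _ hi => by rw [h00, if_neg hi.ne'])
    (fun k j => by
      have := hlead k j 0 (by norm_num)
      rw [mul_zero] at this
      rw [this]
      simp [stencilTaylor, evenSign])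
    (by
      refine ⟨?_, ?_, ?_⟩
      · simpa [Finset.sum_range_succ, evenSign, Nat.factorial, parity_simps] using
          ev 1 0 1 (by norm_num)
      · refine (ev 0 1 1 (by norm_num)).trans ?_
        norm_num [Finset.sum_range_succ, evenSign, Nat.factorial, Nat.even_iff]
      · refine (ev 1 1 1 (by norm_num)).trans ?_
        norm_num [Finset.sum_range_succ, evenSign, Nat.factorial, Nat.even_iff])
    (by
      refine ⟨(ev 1 0 2 (by norm_num)).trans ?_, (ev 0 1 2 (by norm_num)).trans ?_,
        (ev 1 1 2 (by norm_num)).trans ?_⟩ <;>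
        norm_num [Finset.sum_range_succ, evenSign, Nat.factorial, Nat.even_iff])
    (by
      refine ⟨(ev 1 0 3 (by norm_num)).trans ?_, (ev 0 1 3 (by norm_num)).trans ?_,
        (ev 1 1 3 (by norm_num)).trans ?_⟩ <;>
        norm_num [Finset.sum_range_succ, evenSign, Nat.factorial, Nat.even_iff])
  refine ⟨C, hC₁, hC₂, fun d hd => ?_⟩
  have hτ : ∀ k j, ∀ e < 7, stencilTaylor U k j e =
      ∑ i ∈ Finset.range 4, (q k j i).coeff e • U (2 * i) 0 := by
    intro k j e he
    have h1 : ∀ p ∈ Finset.HasAntidiagonal.antidiagonal e,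
        U p.1 p.2 = ∑ i ∈ Finset.range 4, A p.1 p.2 i • U (2 * i) 0 := fun p hp => by
      rw [Finset.HasAntidiagonal.mem_antidiagonal] at hp
      exact (hA p.1 p.2 (by omega)).1
    rw [stencilTaylor, Finset.sum_congr rfl fun p hp => by rw [h1 p hp, Finset.smul_sum],
      Finset.sum_comm]
    refine Finset.sum_congr rfl fun i _ => ?_
    rw [hcoeff _ _ _ _ he, stencilTaylor, Finset.sum_smul]
    simp only [smul_smul, smul_eq_mul]
  have h2 : ∀ k j, ∑ e ∈ Finset.HasAntidiagonal.antidiagonal d,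
      (C k j).coeff e.1 • stencilTaylor U k j e.2 =
      ∑ i ∈ Finset.range 4, (C k j * q k j i).coeff d • U (2 * i) 0 := by
    intro k j
    have h1 : ∀ e ∈ Finset.HasAntidiagonal.antidiagonal d,
        (C k j).coeff e.1 • stencilTaylor U k j e.2 =
        ∑ i ∈ Finset.range 4, (C k j).coeff e.1 • (q k j i).coeff e.2 • U (2 * i) 0 := by
      intro e he
      rw [Finset.HasAntidiagonal.mem_antidiagonal] at he
      rw [hτ k j e.2 (by omega), Finset.smul_sum]
    rw [Finset.sum_congr rfl h1, Finset.sum_comm]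
    refine Finset.sum_congr rfl fun i _ => ?_
    rw [coeff_mul, Finset.sum_smul]
    simp only [smul_smul]
  simp only [h2]
  have h3 : ∀ i ∈ Finset.range 4, ∑ k, ∑ j, (C k j * q k j i).coeff d = 0 := by
    intro i hi
    have := X_pow_dvd_iff.1 (hC₃ i (Finset.mem_range.1 hi)) d hd
    simpa only [finsetSum_coeff] using this
  calc ∑ k, ∑ j, ∑ i ∈ Finset.range 4, (C k j * q k j i).coeff d • U (2 * i) 0
      = ∑ i ∈ Finset.range 4, (∑ k, ∑ j, (C k j * q k j i).coeff d) • U (2 * i) 0 := by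
        simp only [Fin.sum_univ_two, add_smul, Finset.sum_add_distrib]
    _ = 0 := Finset.sum_eq_zero fun i hi => by rw [h3 i hi, zero_smul]

/-- The scheme with the six-th order error, on the level of formal solutions. -/
theorem exists_formal_scheme (hJ : J.a 0 0 ≠ 0) : ∃ S : CornerScheme, S.M = 5 ∧ S.IsPolynomial 6 ∧
    (∀ k j, S.C k j 0 ≠ 0) ∧ ∀ s : J.FormalSolution, ∃ P : ℝ[X], ∀ h : ℝ,
      ∑ k, ∑ j, S.C k j h * ∑ i ∈ Finset.range 7, h ^ i * stencilTaylor s.u k j i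
        - ((∑ d ∈ Finset.range 5, ∑ q ∈ Finset.HasAntidiagonal.antidiagonal d,
            s.f q.1 q.2 * S.Cf q.1 q.2 h)
          + ∑ n ∈ Finset.range 6, s.g₁ n * S.Cg₁ n h + ∑ n ∈ Finset.range 6, s.g₄ n * S.Cg₄ n h)
      = h ^ 7 * P.eval h := by
  obtain ⟨C, hC₁, hC₂, hC₃⟩ := (isHomogeneousJet_jetModData (J := J)).exists_stencil hJ
  -- Vanishing in the quotient means that the coefficient of `h ^ d` on the left is a combination
  -- `c` of data; these combinations are the coefficients of the right-hand side.
  have hF : ∀ d, ∃ c : (ℕ → ℕ → ℝ) × (ℕ → ℝ) × (ℕ → ℝ), d < 7 → ∀ s : J.FormalSolution,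
      dataFunctional J c s = ∑ k, ∑ j, ∑ e ∈ Finset.HasAntidiagonal.antidiagonal d,
        (C k j).coeff e.1 * stencilTaylor s.u k j e.2 := by
    intro d
    by_cases hd : d < 7
    · have h1 := hC₃ d hd
      have h2 : ∀ k j e, stencilTaylor (jetModData J) k j e = Submodule.mkQ _
          (stencilTaylor (fun m n (s : J.FormalSolution) => s.u m n) k j e) := fun k j e => by
        rw [map_stencilTaylor]; rfl
      simp only [h2, ← map_smul, ← map_sum] at h1
      rw [Submodule.mkQ_apply, Submodule.Quotient.mk_eq_zero] at h1
      obtain ⟨c, hc⟩ := h1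
      refine ⟨c, fun _ s => ?_⟩
      rw [hc]
      simp only [Finset.sum_apply, Pi.smul_apply, smul_eq_mul]
      refine Finset.sum_congr rfl fun k _ => Finset.sum_congr rfl fun j _ =>
        Finset.sum_congr rfl fun e _ => ?_
      congr 1
      exact map_stencilTaylor (LinearMap.proj s : (J.FormalSolution → ℝ) →ₗ[ℝ] ℝ)
        (fun m n s => s.u m n) k j e.2
    · exact ⟨0, fun h => absurd h hd⟩
  choose c hc using hF
  have hpoly : ∀ b : ℕ → ℝ, ∃ P : ℝ[X], ∀ h, ∑ d ∈ Finset.range 7, h ^ d * b d = P.eval h :=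
    fun b => ⟨∑ d ∈ Finset.range 7, X ^ d * Polynomial.C (b d), fun h => by
      simp only [eval_finsetSum, eval_mul, eval_pow, eval_X, eval_C]⟩
  refine ⟨⟨5, fun k j h => (C k j).eval h, fun m n h => ∑ d ∈ Finset.range 7, h ^ d * (c d).1 m n,
    fun n h => ∑ d ∈ Finset.range 7, h ^ d * (c d).2.1 n,
    fun n h => ∑ d ∈ Finset.range 7, h ^ d * (c d).2.2 n⟩, rfl,
    ⟨fun k j => ⟨C k j, hC₁ k j, fun _ => rfl⟩, fun m n => hpoly fun d => (c d).1 m n,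
      fun n => hpoly fun d => (c d).2.1 n, fun n => hpoly fun d => (c d).2.2 n⟩, hC₂, fun s => ?_⟩
  -- With the Taylor expansions as polynomials in `h`, the error is divisible by `X ^ 7` once the
  -- coefficients below degree seven agree.
  let T : Fin 2 → Fin 2 → ℝ[X] := fun k j =>
    ∑ i ∈ Finset.range 7, monomial i (stencilTaylor s.u k j i)
  have hT : ∀ k j, ∀ i < 7, (T k j).coeff i = stencilTaylor s.u k j i := fun k j i hi => by
    simp [T, finsetSum_coeff, coeff_monomial, hi]
  have hdvd : X ^ 7 ∣ ∑ k, ∑ j, C k j * T k j -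
      ∑ d ∈ Finset.range 7, monomial d (dataFunctional J (c d) s) := by
    refine X_pow_dvd_iff.2 fun d hd => ?_
    have : (∑ d ∈ Finset.range 7, monomial d (dataFunctional J (c d) s)).coeff d
        = dataFunctional J (c d) s := by simp [finsetSum_coeff, coeff_monomial, hd]
    rw [coeff_sub, this, hc d hd s, sub_eq_zero]
    simp only [finsetSum_coeff]
    refine Finset.sum_congr rfl fun k _ => Finset.sum_congr rfl fun j _ => ?_
    rw [coeff_mul]
    refine Finset.sum_congr rfl fun e he => ?_
    rw [Finset.HasAntidiagonal.mem_antidiagonal] at he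
    rw [hT k j e.2 (by omega)]
  obtain ⟨P, hP⟩ := hdvd
  refine ⟨P, fun h => ?_⟩
  have h1 := congrArg (Polynomial.eval h) hP
  simp only [eval_sub, eval_finsetSum, eval_mul, eval_pow, eval_X, T, eval_monomial] at h1
  rw [← h1]
  congr 1
  · refine Finset.sum_congr rfl fun k _ => Finset.sum_congr rfl fun j _ => ?_
    congr 1
    exact Finset.sum_congr rfl fun i _ => mul_comm _ _
  · simp only [dataFunctional, LinearMap.coe_mk, AddHom.coe_mk, Finset.mul_sum, Finset.sum_mul,
      add_mul, Finset.sum_add_distrib]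
    refine congrArg₂ _ (congrArg₂ _ ?_ ?_) ?_
    · rw [Finset.sum_comm (s := Finset.range 7)]
      refine Finset.sum_congr rfl fun d _ => ?_
      rw [Finset.sum_comm (s := Finset.range 7)]
      exact Finset.sum_congr rfl fun q _ => Finset.sum_congr rfl fun e _ => by ring
    · rw [Finset.sum_comm]
      exact Finset.sum_congr rfl fun d _ => Finset.sum_congr rfl fun n _ => by ring
    · rw [Finset.sum_comm]
      exact Finset.sum_congr rfl fun d _ => Finset.sum_congr rfl fun n _ => by ring

end FormalScheme

end CornerFD

/-! ### From exact solutions to formal ones; the sixth-order scheme -/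

namespace CornerFD

theorem InterfaceDomain.cornerDeriv_add {G : InterfaceDomain} {w w' : ℝ × ℝ → ℝ} (r : ℝ) {m n : ℕ}
    (hw : ContDiffOn ℝ ((m + n : ℕ) : WithTop ℕ∞) w G.D)
    (hw' : ContDiffOn ℝ ((m + n : ℕ) : WithTop ℕ∞) w' G.D) :
    G.cornerDeriv (fun p => r * w p + w' p) m n
      = r * G.cornerDeriv w m n + G.cornerDeriv w' m n := by
  have h := InterfaceDomain.cornerDeriv_sum (G := G) Finset.univ ![r, 1] ![w, w'] m n (by
    intro i _
    fin_cases i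
    · exact hw
    · exact hw')
  simpa [Fin.sum_univ_two] using h

theorem jetMul_congr {Q : Type*} [AddCommGroup Q] [Module ℝ Q] {a a' : ℕ → ℕ → ℝ}
    {U U' : ℕ → ℕ → Q} {m n : ℕ} (ha : ∀ i ≤ m, ∀ j ≤ n, a i j = a' i j)
    (hU : ∀ i ≤ m, ∀ j ≤ n, U i j = U' i j) : jetMul a U m n = jetMul a' U' m n := by
  refine Finset.sum_congr rfl fun q hq => Finset.sum_congr rfl fun p hp => ?_
  rw [Finset.HasAntidiagonal.mem_antidiagonal] at hp hq
  rw [ha _ (by omega) _ (by omega), hU _ (by omega) _ (by omega)]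

theorem InterfaceDomain.cornerDeriv_mul_eq_jetMul {G : InterfaceDomain} {w w' : ℝ × ℝ → ℝ} {m n : ℕ}
    (hw : ContDiffOn ℝ ((m + n : ℕ) : WithTop ℕ∞) w G.D)
    (hw' : ContDiffOn ℝ ((m + n : ℕ) : WithTop ℕ∞) w' G.D) :
    G.cornerDeriv (fun p => w p * w' p) m n = jetMul (G.cornerDeriv w) (G.cornerDeriv w') m n := by
  rw [InterfaceDomain.cornerDeriv_mul m n hw hw', jetMul]
  simp only [smul_eq_mul, mul_assoc]

section Solution

variable {G : InterfaceDomain} {c : Coeffs} {u f : ℝ × ℝ → ℝ} {g₁ g₄ : ℝ → ℝ}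

/-- The differential equation holds up to the boundary of the rectangle. -/
theorem IsSolution.eqOn_D (hc : c.IsRegular G 5) (hs : IsSolution G c 5 u f g₁ g₄) :
    EqOn f (fun p => (-1) * G.pdx (fun q => c.a q * G.pdx u q) p
      + (-1) * G.pdy (fun q => c.a q * G.pdy u q) p) G.D := by
  have hu : ContDiffOn ℝ 7 u G.D := hs.u_smooth
  have ha : ContDiffOn ℝ 6 c.a G.D := hc.a_smooth
  have hflux : ∀ v : ℝ × ℝ, ContDiffOn ℝ 5 (pd G.D v (fun q => c.a q * pd G.D v u q)) G.D := fun v =>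
    contDiffOn_pd G.uniqueDiffOn_D
      (ha.mul (contDiffOn_pd G.uniqueDiffOn_D hu (by norm_num))) (by norm_num)
  refine EqOn.of_subset_closure (s := G.Ω \ closure G.ΓI) (fun p hp => ?_)
    hs.f_smooth.continuousOn ?_ (G.Ω_diff_subset_interior_D.trans interior_subset)
    G.D_subset_closure_Ω_diff
  · rw [← hs.pde p ⟨hp.1, fun h => hp.2 (subset_closure h)⟩]
    ring
  · exact (continuousOn_const.mul (hflux (1, 0)).continuousOn).add
      (continuousOn_const.mul (hflux (0, 1)).continuousOn)

theorem IsSolution.cornerDeriv_pde (hc : c.IsRegular G 5) (hs : IsSolution G c 5 u f g₁ g₄)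
    {m n : ℕ} (h : m + n ≤ 4) :
    jetMul (G.cornerDeriv c.a) (fun i j => G.cornerDeriv u (i + 1) j) (m + 1) n
    + jetMul (G.cornerDeriv c.a) (fun i j => G.cornerDeriv u i (j + 1)) m (n + 1)
      = -G.cornerDeriv f m n := by
  have hu : ContDiffOn ℝ ((7 : ℕ) : WithTop ℕ∞) u G.D := hs.u_smooth
  have ha : ContDiffOn ℝ ((6 : ℕ) : WithTop ℕ∞) c.a G.D := hc.a_smooth
  have hpu : ∀ v : ℝ × ℝ, ContDiffOn ℝ ((6 : ℕ) : WithTop ℕ∞) (pd G.D v u) G.D := fun v =>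
    contDiffOn_pd G.uniqueDiffOn_D hu (by norm_cast)
  have hau : ∀ v : ℝ × ℝ, ContDiffOn ℝ ((6 : ℕ) : WithTop ℕ∞) (fun q => c.a q * pd G.D v u q) G.D :=
    fun v => ha.mul (hpu v)
  have hflux : ∀ v : ℝ × ℝ, ContDiffOn ℝ ((5 : ℕ) : WithTop ℕ∞)
      (pd G.D v (fun q => c.a q * pd G.D v u q)) G.D := fun v =>
    contDiffOn_pd G.uniqueDiffOn_D (hau v) (by norm_cast)
  have h5 : ((m + n : ℕ) : WithTop ℕ∞) ≤ ((5 : ℕ) : WithTop ℕ∞) := by norm_cast; omega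
  have h6 : ∀ k ≤ 6, ((k : ℕ) : WithTop ℕ∞) ≤ ((6 : ℕ) : WithTop ℕ∞) := fun k hk => by
    exact_mod_cast hk
  rw [InterfaceDomain.cornerDeriv_congr (hs.eqOn_D hc) m n]
  rw [InterfaceDomain.cornerDeriv_add (-1) (w := G.pdx (fun q => c.a q * G.pdx u q))
    (w' := fun p => (-1) * G.pdy (fun q => c.a q * G.pdy u q) p) ((hflux (1, 0)).of_le h5)
    (contDiffOn_const.mul ((hflux (0, 1)).of_le h5))]
  have hneg : G.cornerDeriv (fun p => (-1) * G.pdy (fun q => c.a q * G.pdy u q) p) m n =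
      (-1) * G.cornerDeriv (G.pdy (fun q => c.a q * G.pdy u q)) m n := by
    simpa using InterfaceDomain.cornerDeriv_sum (G := G) (Finset.univ : Finset Unit)
      (fun _ => (-1)) (fun _ => G.pdy (fun q => c.a q * G.pdy u q)) m n
      (fun _ _ => (hflux (0, 1)).of_le h5)
  rw [hneg, InterfaceDomain.cornerDeriv_pdx (w := fun q => c.a q * G.pdx u q) m n ((hau (1, 0)).of_le (h6 _ (by omega))),
    InterfaceDomain.cornerDeriv_pdy,
    InterfaceDomain.cornerDeriv_mul_eq_jetMul (w' := G.pdx u) (ha.of_le (h6 _ (by omega)))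
      ((hpu (1, 0)).of_le (h6 _ (by omega))),
    InterfaceDomain.cornerDeriv_mul_eq_jetMul (w' := G.pdy u) (ha.of_le (h6 _ (by omega)))
      ((hpu (0, 1)).of_le (h6 _ (by omega)))]
  rw [jetMul_congr (U' := fun i j => G.cornerDeriv u (i + 1) j) (m := m + 1) (n := n)
    (fun _ _ _ _ => rfl) (fun i hi j hj => InterfaceDomain.cornerDeriv_pdx i j
      (hu.of_le (by norm_cast; omega)))]
  rw [jetMul_congr (U := G.cornerDeriv (G.pdy u)) (U' := fun i j => G.cornerDeriv u i (j + 1))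
    (m := m) (n := n + 1)
    (fun _ _ _ _ => rfl) (fun i hi j hj => InterfaceDomain.cornerDeriv_pdy i j)]
  ring

/-- Regarding `α` as a function on `D` that does not depend on `x` extends the boundary expression
to all of `D`, where its `y` derivatives at the corner follow from the Leibniz rule. -/
theorem IsSolution.leftDeriv_robin (hc : c.IsRegular G 5) (hs : IsSolution G c 5 u f g₁ g₄)
    {n : ℕ} (h : n ≤ 5) :
    -G.cornerDeriv u 1 n + ∑ q ∈ Finset.HasAntidiagonal.antidiagonal n,
      ((n.choose q.1 : ℝ) * G.leftDeriv c.α q.1) • G.cornerDeriv u 0 q.2 = G.leftDeriv g₁ n := by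
  have hu : ContDiffOn ℝ ((7 : ℕ) : WithTop ℕ∞) u G.D := hs.u_smooth
  have hα : ContDiffOn ℝ ((5 : ℕ) : WithTop ℕ∞) c.α (Icc G.l₃ G.l₄) := hc.α_smooth
  have hα' : ContDiffOn ℝ ((5 : ℕ) : WithTop ℕ∞) (fun p : ℝ × ℝ => c.α p.2) G.D :=
    hα.comp contDiff_snd.contDiffOn fun p hp => (G.D_subset_Icc hp).2
  have hpu : ContDiffOn ℝ ((6 : ℕ) : WithTop ℕ∞) (G.pdx u) G.D :=
    contDiffOn_pd G.uniqueDiffOn_D hu (by norm_cast)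
  have hn : ∀ i ≤ n, ∀ k, 5 ≤ k → ((i : ℕ) : WithTop ℕ∞) ≤ ((k : ℕ) : WithTop ℕ∞) := by
    intro i hi k hk; norm_cast; omega
  have hαu := (hα'.of_le (hn n le_rfl 5 le_rfl)).mul (hu.of_le (hn n le_rfl 7 (by norm_num)))
  have hpu' := hpu.of_le (hn n le_rfl 6 (by norm_num))
  rw [InterfaceDomain.leftDeriv_eq_cornerDeriv (w := fun p => (-1) * G.pdx u p + c.α p.2 * u p) n
    ((contDiffOn_const.mul hpu').add hαu) hs.g₁_smooth.continuousOn
    (fun p hp => by rw [← hs.robin_left p hp]; ring)]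
  rw [InterfaceDomain.cornerDeriv_add (-1) (w := G.pdx u) (w' := fun p => c.α p.2 * u p)
      (by simpa using hpu') (by simpa using hαu),
    InterfaceDomain.cornerDeriv_pdx 0 n (hu.of_le (by norm_cast; omega)),
    InterfaceDomain.cornerDeriv_mul 0 n (by simpa using hα'.of_le (hn n le_rfl 5 le_rfl))
      (by simpa using hu.of_le (hn n le_rfl 7 (by norm_num)))]
  rw [neg_one_mul, zero_add]
  congr 1
  refine Finset.sum_congr rfl fun q hq => ?_
  rw [Finset.HasAntidiagonal.mem_antidiagonal] at hq
  rw [InterfaceDomain.leftDeriv_eq_cornerDeriv (w := fun p => c.α p.2) q.1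
    (hα'.of_le (hn _ (by omega) 5 le_rfl)) hα.continuousOn (fun p _ => rfl)]
  simp [mul_assoc]

theorem IsSolution.topDeriv_robin (hc : c.IsRegular G 5) (hs : IsSolution G c 5 u f g₁ g₄)
    {m : ℕ} (h : m ≤ 5) :
    G.cornerDeriv u m 1 + ∑ p ∈ Finset.HasAntidiagonal.antidiagonal m,
      ((m.choose p.1 : ℝ) * G.topDeriv c.β p.1) • G.cornerDeriv u p.2 0 = G.topDeriv g₄ m := by
  have hu : ContDiffOn ℝ ((7 : ℕ) : WithTop ℕ∞) u G.D := hs.u_smooth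
  have hβ : ContDiffOn ℝ ((5 : ℕ) : WithTop ℕ∞) c.β (Icc G.l₁ G.l₂) := hc.β_smooth
  have hβ' : ContDiffOn ℝ ((5 : ℕ) : WithTop ℕ∞) (fun p : ℝ × ℝ => c.β p.1) G.D :=
    hβ.comp contDiff_fst.contDiffOn fun p hp => (G.D_subset_Icc hp).1
  have hpu : ContDiffOn ℝ ((6 : ℕ) : WithTop ℕ∞) (G.pdy u) G.D :=
    contDiffOn_pd G.uniqueDiffOn_D hu (by norm_cast)
  have hn : ∀ i ≤ m, ∀ k, 5 ≤ k → ((i : ℕ) : WithTop ℕ∞) ≤ ((k : ℕ) : WithTop ℕ∞) := by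
    intro i hi k hk; norm_cast; omega
  have hβu := (hβ'.of_le (hn m le_rfl 5 le_rfl)).mul (hu.of_le (hn m le_rfl 7 (by norm_num)))
  have hpu' := hpu.of_le (hn m le_rfl 6 (by norm_num))
  rw [InterfaceDomain.topDeriv_eq_cornerDeriv (w := fun p => 1 * G.pdy u p + c.β p.1 * u p) m
    ((contDiffOn_const.mul hpu').add hβu) hs.g₄_smooth.continuousOn
    (fun p hp => by rw [← hs.robin_top p hp]; ring)]
  rw [InterfaceDomain.cornerDeriv_add 1 (w := G.pdy u) (w' := fun p => c.β p.1 * u p)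
      (by simpa using hpu') (by simpa using hβu),
    InterfaceDomain.cornerDeriv_pdy m 0,
    InterfaceDomain.cornerDeriv_mul m 0 (by simpa using hβ'.of_le (hn m le_rfl 5 le_rfl))
      (by simpa using hu.of_le (hn m le_rfl 7 (by norm_num)))]
  rw [one_mul, zero_add]
  congr 1
  rw [show Finset.HasAntidiagonal.antidiagonal 0 = {((0 : ℕ), (0 : ℕ))} from rfl,
    Finset.sum_singleton]
  refine Finset.sum_congr rfl fun q hq => ?_
  rw [Finset.HasAntidiagonal.mem_antidiagonal] at hq
  rw [InterfaceDomain.topDeriv_eq_cornerDeriv (w := fun p => c.β p.1) q.1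
    (hβ'.of_le (hn _ (by omega) 5 le_rfl)) hβ.continuousOn (fun p _ => rfl)]
  simp [mul_assoc]

/-- The derivatives at the corner of an exact solution and its data. -/
noncomputable def IsSolution.formalSolution (hc : c.IsRegular G 5)
    (hs : IsSolution G c 5 u f g₁ g₄) : (c.jet G 5).FormalSolution where
  u := G.cornerDeriv u
  f := G.cornerDeriv f
  g₁ := G.leftDeriv g₁
  g₄ := G.topDeriv g₄
  pde m n h := by
    rw [← hs.cornerDeriv_pde hc h]
    congr 1 <;>
    exact jetMul_congr (fun i hi j hj => if_pos (by omega)) (fun _ _ _ _ => rfl)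
  left n h := by
    rw [← hs.leftDeriv_robin hc h]
    congr 1
    refine Finset.sum_congr rfl fun q hq => ?_
    rw [Finset.HasAntidiagonal.mem_antidiagonal] at hq
    rw [show (c.jet G 5).α q.1 = G.leftDeriv c.α q.1 from if_pos (by omega)]
  top m h := by
    rw [← hs.topDeriv_robin hc h]
    congr 1
    refine Finset.sum_congr rfl fun q hq => ?_
    rw [Finset.HasAntidiagonal.mem_antidiagonal] at hq
    rw [show (c.jet G 5).β q.1 = G.topDeriv c.β q.1 from if_pos (by omega)]

end Solution

theorem isBigO_polynomial_gridSize (G : InterfaceDomain) (P : Polynomial ℝ) :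
    (fun N₁ => P.eval (G.gridSize N₁)) =O[atTop] (fun _ : ℕ => (1 : ℝ)) :=
  ((P.continuous.tendsto 0).comp G.tendsto_gridSize).isBigO_one ℝ

/-- The sixth-order scheme built from the jet of the coefficients at the corner. -/
theorem exists_sixth_order_scheme (J : CornerJet) : ∃ S : CornerScheme,
    ∀ (G : InterfaceDomain) (c : Coeffs), c.IsRegular G 5 → c.jet G 5 = J →
      S.M = 5 ∧ S.IsPolynomial 6 ∧ (∀ k j, S.C k j 0 ≠ 0) ∧ S.HasOrder G c 5 6 := by
  -- The scheme is chosen for every jet. One with `a 0 0 = 0` belongs to no regular problem, as `a`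
  -- is positive at the corner, so any value will do.
  by_cases hJ : J.a 0 0 = 0
  · refine ⟨⟨0, 0, 0, 0, 0⟩, fun G c hc h => absurd hJ ?_⟩
    rw [← h]
    exact (hc.a_pos _ G.corner_mem_D).ne'
  obtain ⟨S, hM, hpoly, hne, hS⟩ := exists_formal_scheme hJ
  refine ⟨S, fun G c hc h => ⟨hM, hpoly, hne, fun u f g₁ g₄ hs => ?_⟩⟩
  subst h
  obtain ⟨P, hP⟩ := hS (hs.formalSolution hc)
  have hu : ContDiffOn ℝ ((6 + 1 : ℕ) : WithTop ℕ∞) u G.D := hs.u_smooth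
  have hT := InterfaceDomain.taylor_gridPoint 6 hu
  -- The error is the Taylor remainder weighted by bounded coefficients, plus the formal error,
  -- which is `h ^ 7` times a polynomial.
  have h1 : (fun N₁ => ∑ k, ∑ j, S.C k j (G.gridSize N₁) * (u (G.gridPoint N₁ k j) -
      ∑ i ∈ Finset.range 7, G.gridSize N₁ ^ i * stencilTaylor (G.cornerDeriv u) k j i))
      =O[atTop] (fun N₁ : ℕ => G.gridSize N₁ ^ 7) := by
    have h0 : ∀ k j, (fun N₁ => S.C k j (G.gridSize N₁) * (u (G.gridPoint N₁ k j) -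
        ∑ i ∈ Finset.range 7, G.gridSize N₁ ^ i * stencilTaylor (G.cornerDeriv u) k j i))
        =O[atTop] (fun N₁ : ℕ => G.gridSize N₁ ^ 7) := fun k j => by
      obtain ⟨C, -, hC⟩ := hpoly.C_poly k j
      simp only [hC]
      have := (isBigO_polynomial_gridSize G C).mul (hT k j)
      simp only [one_mul] at this
      exact this
    simp only [Fin.sum_univ_two]
    exact ((h0 0 0).add (h0 0 1)).add ((h0 1 0).add (h0 1 1))
  have h2 : (fun N₁ => G.gridSize N₁ ^ 7 * P.eval (G.gridSize N₁))
      =O[atTop] (fun N₁ : ℕ => G.gridSize N₁ ^ 7) := by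
    simpa using (isBigO_refl (fun N₁ : ℕ => G.gridSize N₁ ^ 7) atTop).mul
      (isBigO_polynomial_gridSize G P)
  refine (h1.add h2).congr_left fun N₁ => ?_
  rw [← hP]
  simp only [CornerScheme.lhs, CornerScheme.rhs, hM, mul_sub, Finset.sum_sub_distrib]
  simp only [IsSolution.formalSolution]
  ring

end CornerFD

/-! ### Harmonic test solutions with vanishing data -/

namespace CornerFD

section TestSolutions

open Polynomial

/-- The even monomial `t ^ (2 i) / (2 i)!` corrected so that its derivative at `0` is `r` times its
value. -/
noncomputable def edgePoly (r : ℝ) (i : ℕ) : ℝ[X] :=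
  Polynomial.C (1 / (2 * i).factorial : ℝ) * X ^ (2 * i)
    + Polynomial.C (r / (2 * i + 1).factorial : ℝ) * X ^ (2 * i + 1)

/-- The condition has content only for `i = 0`; otherwise both sides vanish. The odd terms for
larger `i` are there so that two derivatives lower `i` by one. -/
theorem edgePoly_derivative_eval_zero (r : ℝ) (i : ℕ) :
    (edgePoly r i).derivative.eval 0 = r * (edgePoly r i).eval 0 := by
  rcases i with _ | i
  · simp [edgePoly]
  · simp [edgePoly, derivative_X_pow, mul_add, pow_succ]

theorem edgePoly_derivative_derivative_zero (r : ℝ) :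
    (edgePoly r 0).derivative.derivative = 0 := by
  simp [edgePoly]

theorem edgePoly_derivative_derivative_succ (r : ℝ) (i : ℕ) :
    (edgePoly r (i + 1)).derivative.derivative = edgePoly r i := by
  have e1 : ((2 * (i + 1)).factorial : ℝ) = (2 * i + 2) * (2 * i + 1) * (2 * i).factorial := by
    rw [show 2 * (i + 1) = 2 * i + 1 + 1 by ring, Nat.factorial_succ, Nat.factorial_succ]
    push_cast; ring
  have e2 : ((2 * (i + 1) + 1).factorial : ℝ)
      = (2 * i + 3) * (2 * i + 2) * (2 * i + 1).factorial := by
    rw [show 2 * (i + 1) + 1 = 2 * i + 1 + 1 + 1 by ring, Nat.factorial_succ, Nat.factorial_succ]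
    push_cast; ring
  have h1 : ((2 * i).factorial : ℝ) ≠ 0 := by positivity
  have h2 : ((2 * i + 1).factorial : ℝ) ≠ 0 := by positivity
  simp only [edgePoly, derivative_add, derivative_C_mul_X_pow]
  rw [e1, e2]
  congr 1
  · rw [show 2 * (i + 1) - 1 - 1 = 2 * i by omega, show 2 * (i + 1) - 1 = 2 * i + 1 by omega]
    congr 2
    push_cast
    field_simp
  · rw [show 2 * (i + 1) + 1 - 1 - 1 = 2 * i + 1 by omega,
      show 2 * (i + 1) + 1 - 1 = 2 * i + 2 by omega]
    congr 2
    push_cast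
    field_simp
    ring

/-- The sum of the products `A_q(x - x₀) B_q(y - y₀)`. -/
noncomputable def sepSum {ι : Type*} (s : Finset ι) (A B : ι → ℝ[X]) (z : ℝ × ℝ) : ℝ × ℝ → ℝ :=
  fun p => ∑ q ∈ s, (A q).eval (p.1 - z.1) * (B q).eval (p.2 - z.2)

variable {ι : Type*} (s : Finset ι) (A B : ι → ℝ[X]) (z : ℝ × ℝ)

theorem hasFDerivAt_sepSum (p : ℝ × ℝ) : ∃ L : ℝ × ℝ →L[ℝ] ℝ, HasFDerivAt (sepSum s A B z) L p ∧
    L (1, 0) = sepSum s (fun q => (A q).derivative) B z p ∧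
    L (0, 1) = sepSum s A (fun q => (B q).derivative) z p := by
  have h : ∀ q ∈ s, HasFDerivAt (fun p : ℝ × ℝ => (A q).eval (p.1 - z.1) * (B q).eval (p.2 - z.2))
      ((A q).eval (p.1 - z.1) • (B q).derivative.eval (p.2 - z.2) • ContinuousLinearMap.snd ℝ ℝ ℝ
        + (B q).eval (p.2 - z.2) • (A q).derivative.eval (p.1 - z.1) •
          ContinuousLinearMap.fst ℝ ℝ ℝ) p := by
    intro q _
    have hA := ((A q).hasDerivAt (p.1 - z.1)).comp_hasFDerivAt p
      ((hasFDerivAt_fst (𝕜 := ℝ) (p := p)).sub_const z.1)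
    have hB := ((B q).hasDerivAt (p.2 - z.2)).comp_hasFDerivAt p
      ((hasFDerivAt_snd (𝕜 := ℝ) (p := p)).sub_const z.2)
    exact hA.mul hB
  refine ⟨_, HasFDerivAt.fun_sum h, ?_, ?_⟩
  · simp [sepSum, sum_apply, mul_comm]
  · simp [sepSum, sum_apply, mul_comm]

theorem contDiff_sepSum {n : WithTop ℕ∞} : ContDiff ℝ n (sepSum s A B z) := by
  refine ContDiff.sum fun q _ => ?_
  have h : ∀ P : ℝ[X], ContDiff ℝ n fun x => P.eval x := fun P => by
    simpa [coe_aeval_eq_eval] using P.contDiff_aeval (𝕜 := ℝ) n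
  exact ((h (A q)).comp (contDiff_fst.sub contDiff_const)).mul
    ((h (B q)).comp (contDiff_snd.sub contDiff_const))

variable {G : InterfaceDomain}

theorem pdx_sepSum : EqOn (G.pdx (sepSum s A B z)) (sepSum s (fun q => (A q).derivative) B z) G.D := by
  intro p hp
  obtain ⟨L, hL, h1, -⟩ := hasFDerivAt_sepSum s A B z p
  rw [← h1]
  exact pd_eq_of_hasFDerivAt G.uniqueDiffOn_D hp hL

theorem pdy_sepSum : EqOn (G.pdy (sepSum s A B z)) (sepSum s A (fun q => (B q).derivative) z) G.D := by
  intro p hp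
  obtain ⟨L, hL, -, h1⟩ := hasFDerivAt_sepSum s A B z p
  rw [← h1]
  exact pd_eq_of_hasFDerivAt G.uniqueDiffOn_D hp hL

/-- The harmonic polynomial with leading part `Re (x + i y) ^ (2 n) / (2 n)!` at the corner which
satisfies the homogeneous Robin conditions with the constants `α₀` and `β₀`. -/
noncomputable def robinHarmonic (G : InterfaceDomain) (α₀ β₀ : ℝ) (n : ℕ) : ℝ × ℝ → ℝ :=
  sepSum (Finset.HasAntidiagonal.antidiagonal n)
    (fun q => Polynomial.C ((-1) ^ q.2) * edgePoly α₀ q.1) (fun q => edgePoly (-β₀) q.2) G.corner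

/-- Two derivatives in `x` lower the first index and two in `y` the second. Both sums then run over
the antidiagonal of `n - 1`, with opposite signs. -/
theorem laplacian_robinHarmonic (α₀ β₀ : ℝ) (n : ℕ) (x y : ℝ) :
    ∑ q ∈ Finset.HasAntidiagonal.antidiagonal n,
      (Polynomial.C ((-1) ^ q.2) * edgePoly α₀ q.1).derivative.derivative.eval x
        * (edgePoly (-β₀) q.2).eval y
    + ∑ q ∈ Finset.HasAntidiagonal.antidiagonal n,
      (Polynomial.C ((-1) ^ q.2) * edgePoly α₀ q.1).eval x
        * (edgePoly (-β₀) q.2).derivative.derivative.eval y = 0 := by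
  rcases n with _ | n
  · simp [edgePoly_derivative_derivative_zero]
  · rw [Finset.Nat.sum_antidiagonal_succ, Finset.Nat.sum_antidiagonal_succ']
    simp only [derivative_C_mul, edgePoly_derivative_derivative_zero,
      edgePoly_derivative_derivative_succ, mul_zero, eval_zero, zero_mul, zero_add,
      eval_mul, eval_C]
    rw [← Finset.sum_add_distrib]
    refine Finset.sum_eq_zero fun q _ => ?_
    ring

/-- The source is by definition what the operator produces, so `a` may vary here and only the Robin
conditions have content. -/
theorem isSolution_robinHarmonic {c : Coeffs} {α₀ β₀ : ℝ} (hc : c.IsRegular G ⊤)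
    (hα : c.α = fun _ => α₀) (hβ : c.β = fun _ => β₀) (n : ℕ) :
    IsSolution G c ⊤ (robinHarmonic G α₀ β₀ n)
      (fun p => -(G.pdx (fun q => c.a q * G.pdx (robinHarmonic G α₀ β₀ n) q) p
        + G.pdy (fun q => c.a q * G.pdy (robinHarmonic G α₀ β₀ n) q) p)) 0 0 where
  u_smooth := (contDiff_sepSum _ _ _ _).contDiffOn
  f_smooth := by
    have ha : ContDiffOn ℝ ∞ c.a G.D := hc.a_smooth
    have hu : ContDiffOn ℝ ∞ (robinHarmonic G α₀ β₀ n) G.D :=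
      (contDiff_sepSum _ _ _ _).contDiffOn
    have hflux : ∀ v : ℝ × ℝ, ContDiffOn ℝ ∞
        (pd G.D v (fun q => c.a q * pd G.D v (robinHarmonic G α₀ β₀ n) q)) G.D := fun v =>
      contDiffOn_pd G.uniqueDiffOn_D
        (ha.mul (contDiffOn_pd G.uniqueDiffOn_D hu (by rfl))) (by rfl)
    exact ((hflux (1, 0)).add (hflux (0, 1))).neg
  g₁_smooth := contDiffOn_const
  g₄_smooth := contDiffOn_const
  pde _ _ := rfl
  robin_left p hp := by
    obtain ⟨⟨h1, -⟩, h2⟩ := hp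
    rw [mem_singleton_iff] at h1
    rw [robinHarmonic, pdx_sepSum _ _ _ _ h2, hα]
    simp only [sepSum, h1, InterfaceDomain.corner, sub_self, derivative_C_mul, eval_mul, eval_C,
      edgePoly_derivative_eval_zero, Finset.mul_sum, Pi.zero_apply, ← Finset.sum_neg_distrib,
      ← Finset.sum_add_distrib]
    exact Finset.sum_eq_zero fun q _ => by ring
  robin_top p hp := by
    obtain ⟨⟨-, h1⟩, h2⟩ := hp
    rw [mem_singleton_iff] at h1
    rw [robinHarmonic, pdy_sepSum _ _ _ _ h2, hβ]
    simp only [sepSum, h1, InterfaceDomain.corner, sub_self, eval_mul, eval_C,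
      edgePoly_derivative_eval_zero, Finset.mul_sum, Pi.zero_apply, ← Finset.sum_add_distrib]
    exact Finset.sum_eq_zero fun q _ => by ring

theorem source_robinHarmonic_eventuallyEq {c : Coeffs} {a₀ α₀ β₀ : ℝ}
    (ha : ∀ᶠ q in 𝓝[G.D] G.corner, c.a q = a₀) (n : ℕ) :
    (fun p => -(G.pdx (fun q => c.a q * G.pdx (robinHarmonic G α₀ β₀ n) q) p
        + G.pdy (fun q => c.a q * G.pdy (robinHarmonic G α₀ β₀ n) q) p))
      =ᶠ[𝓝[G.D] G.corner] fun _ => 0 := by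
  set s := Finset.HasAntidiagonal.antidiagonal n
  set A : ℕ × ℕ → ℝ[X] := fun q => Polynomial.C ((-1) ^ q.2) * edgePoly α₀ q.1 with hA
  set B : ℕ × ℕ → ℝ[X] := fun q => edgePoly (-β₀) q.2 with hB
  have hrh : robinHarmonic G α₀ β₀ n = sepSum s A B G.corner := rfl
  have hx : (fun q => c.a q * G.pdx (robinHarmonic G α₀ β₀ n) q) =ᶠ[𝓝[G.D] G.corner]
      sepSum s (fun q => Polynomial.C a₀ * (A q).derivative) B G.corner := by
    filter_upwards [ha, self_mem_nhdsWithin] with q hq hqD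
    rw [hq, hrh, pdx_sepSum _ _ _ _ hqD]
    simp only [sepSum, Finset.mul_sum, eval_mul, eval_C, mul_assoc]
  have hy : (fun q => c.a q * G.pdy (robinHarmonic G α₀ β₀ n) q) =ᶠ[𝓝[G.D] G.corner]
      sepSum s (fun q => Polynomial.C a₀ * A q) (fun q => (B q).derivative) G.corner := by
    filter_upwards [ha, self_mem_nhdsWithin] with q hq hqD
    rw [hq, hrh, pdy_sepSum _ _ _ _ hqD]
    simp only [sepSum, Finset.mul_sum, eval_mul, eval_C, mul_assoc]
  filter_upwards [pd_eventuallyEq (v := (1, 0)) hx, pd_eventuallyEq (v := (0, 1)) hy,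
    self_mem_nhdsWithin] with p h1 h2 hp
  have h3 := pdx_sepSum s (fun q => Polynomial.C a₀ * (A q).derivative) B G.corner hp
  have h4 := pdy_sepSum s (fun q => Polynomial.C a₀ * A q) (fun q => (B q).derivative) G.corner hp
  have h5 := laplacian_robinHarmonic α₀ β₀ n (p.1 - G.corner.1) (p.2 - G.corner.2)
  have h6 := h1.trans h3
  have h7 := h2.trans h4
  change -(pd G.D (1, 0) (fun q => c.a q * G.pdx (robinHarmonic G α₀ β₀ n) q) p
    + pd G.D (0, 1) (fun q => c.a q * G.pdy (robinHarmonic G α₀ β₀ n) q) p) = 0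
  rw [h6, h7]
  simp only [sepSum, derivative_C_mul, eval_mul, eval_C] at h5 ⊢
  simp only [mul_assoc, ← Finset.mul_sum] at h5 ⊢
  rw [neg_eq_zero, ← mul_add]
  simp only [hA, hB, derivative_C_mul, eval_mul, eval_C, mul_assoc]
  rw [h5, mul_zero]

/-- All derivatives of the data vanish at the corner, so the right-hand side is zero whatever its
coefficients and the left-hand side alone bears the error bound. -/
theorem lhs_robinHarmonic_isBigO {c : Coeffs} {a₀ α₀ β₀ : ℝ} (hc : c.IsRegular G ⊤)
    (ha : ∀ᶠ q in 𝓝[G.D] G.corner, c.a q = a₀)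
    (hα : c.α = fun _ => α₀) (hβ : c.β = fun _ => β₀) {S : CornerScheme} {p : ℕ}
    (hS : S.HasOrder G c ⊤ p) (n : ℕ) :
    (fun N₁ => S.lhs G (robinHarmonic G α₀ β₀ n) N₁)
      =O[atTop] fun N₁ : ℕ => G.gridSize N₁ ^ (p + 1) := by
  refine (hS _ _ _ _ (isSolution_robinHarmonic hc hα hβ n)).congr_left fun N₁ => ?_
  have hf : ∀ i j, G.cornerDeriv (fun p =>
      -(G.pdx (fun q => c.a q * G.pdx (robinHarmonic G α₀ β₀ n) q) p
        + G.pdy (fun q => c.a q * G.pdy (robinHarmonic G α₀ β₀ n) q) p)) i j = 0 := by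
    intro i j
    have h := pd_iterate_eventuallyEq (v := (1, 0)) i (pd_iterate_eventuallyEq (v := (0, 1)) j
      (source_robinHarmonic_eventuallyEq (α₀ := α₀) (β₀ := β₀) ha n))
    rw [InterfaceDomain.cornerDeriv_eq_pd, h.eq_of_nhdsWithin G.corner_mem_D, pd_iterate_zero,
      pd_iterate_zero]
  have h1 : ∀ i, G.leftDeriv 0 i = 0 := fun i => by
    rw [InterfaceDomain.leftDeriv_eq_cornerDeriv (g := 0) (w := fun _ => 0) i contDiffOn_const
      continuousOn_const (fun _ _ => rfl), InterfaceDomain.cornerDeriv_eq_pd, pd_iterate_zero,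
      pd_iterate_zero]
  have h4 : ∀ i, G.topDeriv 0 i = 0 := fun i => by
    rw [InterfaceDomain.topDeriv_eq_cornerDeriv (g := 0) (w := fun _ => 0) i contDiffOn_const
      continuousOn_const (fun _ _ => rfl), InterfaceDomain.cornerDeriv_eq_pd, pd_iterate_zero,
      pd_iterate_zero]
  simp only [CornerScheme.rhs, hf, h1, h4, zero_mul, Finset.sum_const_zero, add_zero, sub_zero]

theorem lhs_robinHarmonic (S : CornerScheme) (α₀ β₀ : ℝ) (n : ℕ) {N₁ : ℕ} (hN : 0 < N₁) :
    S.lhs G (robinHarmonic G α₀ β₀ n) N₁ = ∑ k : Fin 2, ∑ j : Fin 2, S.C k j (G.gridSize N₁) *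
      ∑ q ∈ Finset.HasAntidiagonal.antidiagonal n, (-1) ^ q.2 *
        (edgePoly α₀ q.1).eval (G.gridSize N₁ * ((k : ℕ) : ℝ)) *
        (edgePoly (-β₀) q.2).eval (-(G.gridSize N₁ * ((j : ℕ) : ℝ))) := by
  simp only [CornerScheme.lhs, InterfaceDomain.gridPoint_eq hN, robinHarmonic, sepSum, eval_mul,
    eval_C]
  simp

end TestSolutions

end CornerFD

/-! ### No order beyond six: Cramer's rule -/

namespace CornerFD

/-- Cramer's rule for one unknown `c`: `δ` is the determinant with its simple zero divided out, the
`M`'s are cofactors and the `t`'s rescaled right-hand sides. -/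
theorem tendsto_zero_of_cramer {l : Filter ℕ} {h c t₁ t₂ t₃ : ℕ → ℝ} (hh : Tendsto h l (𝓝 0))
    (ht₁ : Tendsto t₁ l (𝓝 0)) (ht₂ : Tendsto t₂ l (𝓝 0)) (ht₃ : Tendsto t₃ l (𝓝 0))
    {M₁ M₂ M₃ δ : ℝ → ℝ} (hM₁ : Continuous M₁) (hM₂ : Continuous M₂) (hM₃ : Continuous M₃)
    (hδ : Continuous δ) (hδ0 : δ 0 ≠ 0)
    (heq : ∀ᶠ N in l, δ (h N) * c N = M₁ (h N) * t₁ N + M₂ (h N) * t₂ N + M₃ (h N) * t₃ N) :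
    Tendsto c l (𝓝 0) := by
  have hlim : ∀ {M : ℝ → ℝ}, Continuous M → Tendsto (fun N => M (h N)) l (𝓝 (M 0)) := fun hM =>
    (hM.tendsto 0).comp hh
  have h1 := ((((hlim hM₁).mul ht₁).add ((hlim hM₂).mul ht₂)).add ((hlim hM₃).mul ht₃)).div
    (hlim hδ) hδ0
  simp only [mul_zero, add_zero, zero_div] at h1
  refine h1.congr' ?_
  filter_upwards [heq, (hlim hδ).eventually_ne hδ0] with N h2 h3
  simp only [Pi.div_apply]
  rw [← h2]
  field_simp

/-- A stencil which is exact to order eight on the first four test solutions tends to zero. -/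
theorem tendsto_zero_of_isBigO {G : InterfaceDomain} {α₀ β₀ : ℝ} (hαβ : α₀ ≠ β₀) {S : CornerScheme}
    (hS : ∀ n < 4, (fun N₁ => S.lhs G (robinHarmonic G α₀ β₀ n) N₁)
      =O[atTop] fun N₁ : ℕ => G.gridSize N₁ ^ 8) (k j : Fin 2) :
    Tendsto (fun N₁ : ℕ => S.C k j (G.gridSize N₁)) atTop (𝓝 0) := by
  have hh := G.tendsto_gridSize
  have hpos : ∀ᶠ N₁ : ℕ in atTop, 0 < N₁ ∧ 0 < G.gridSize N₁ := by
    filter_upwards [eventually_gt_atTop 0] with N hN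
    exact ⟨hN, InterfaceDomain.gridSize_pos hN⟩
  -- Row `n` has size `h ^ (2 n)`, and one more power of `h` pays for the zero of the determinant.
  -- The bound `h ^ 8` leaves `h ^ (7 - 2 n)`, just enough for `n = 3`.
  have ht : ∀ n < 4, Tendsto (fun N₁ : ℕ => (2 * n).factorial *
      (S.lhs G (robinHarmonic G α₀ β₀ n) N₁ / G.gridSize N₁ ^ (2 * n + 1))) atTop (𝓝 0) := by
    intro n hn
    have h1 : (fun N₁ : ℕ => S.lhs G (robinHarmonic G α₀ β₀ n) N₁ / G.gridSize N₁ ^ (2 * n + 1))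
        =O[atTop] fun N₁ : ℕ => G.gridSize N₁ := by
      refine ((hS n hn).mul (isBigO_refl (fun N₁ : ℕ => (G.gridSize N₁ ^ (2 * n + 1))⁻¹) _)).trans ?_
      have h2 : (fun N₁ : ℕ => G.gridSize N₁ ^ 8 * (G.gridSize N₁ ^ (2 * n + 1))⁻¹)
          =ᶠ[atTop] fun N₁ : ℕ => G.gridSize N₁ ^ (6 - 2 * n) * G.gridSize N₁ := by
        filter_upwards [hpos] with N hN
        have h0 := hN.2.ne'
        rw [← div_eq_mul_inv, div_eq_iff (pow_ne_zero _ h0), mul_assoc, ← pow_succ', ← pow_add]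
        congr 1
        omega
      refine h2.trans_isBigO ?_
      have h3 : (fun N₁ : ℕ => G.gridSize N₁ ^ (6 - 2 * n)) =O[atTop] fun _ => (1 : ℝ) :=
        ((continuous_pow (6 - 2 * n)).tendsto (0 : ℝ) |>.comp hh).isBigO_one ℝ
      simpa using h3.mul (isBigO_refl (fun N₁ : ℕ => G.gridSize N₁) atTop)
    simpa using (h1.trans_tendsto hh).const_mul ((2 * n).factorial : ℝ)
  set L : ℕ → ℕ → ℝ := fun n N₁ => (2 * n).factorial *
      (S.lhs G (robinHarmonic G α₀ β₀ n) N₁ / G.gridSize N₁ ^ (2 * n + 1)) with hL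
  -- The correction factors of `edgePoly`: its values at `h` for `α₀`, and at `-h` for `-β₀`, are `h
  -- ^ (2 i) / (2 i)!` times `a (2 i + 1) h` and `b (2 i + 1) h`.
  let a : ℝ → ℝ → ℝ := fun n h => 1 + α₀ * h / n
  let b : ℝ → ℝ → ℝ := fun n h => 1 + β₀ * h / n
  let e : ℝ → ℝ := fun h => a 5 h * b 1 h - 6 * (a 3 h * b 3 h) + a 1 h * b 5 h
  -- The determinant of the rows `n = 1, 2, 3` in the unknowns `C 1 0`, `C 0 1`, `C 1 1` is `h * δ
  -- h`. Since `e 0 = -4`, `δ 0 = 20 / 7 * (α₀ - β₀)`.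
  let δ : ℝ → ℝ := fun h => (α₀ - β₀) * (4 / 21 * e h + 8 / 7 * (a 3 h * b 5 h + a 5 h * b 3 h)
    + 2 / 3 * (a 5 h * b 7 h + a 7 h * b 5 h))
  have ha : ∀ n, Continuous (a n) := fun n => by fun_prop
  have hb : ∀ n, Continuous (b n) := fun n => by fun_prop
  have he : Continuous e := by fun_prop
  have hδ : Continuous δ := by fun_prop
  have hδ0 : δ 0 ≠ 0 := by
    simp only [δ, e, a, b, mul_zero, zero_div, add_zero]
    refine mul_ne_zero (sub_ne_zero.2 hαβ) (by norm_num)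
  have hrow : ∀ᶠ N in atTop,
      (G.gridSize N * L 0 N = S.C 0 0 (G.gridSize N) + a 1 (G.gridSize N) * S.C 1 0 (G.gridSize N)
        + b 1 (G.gridSize N) * S.C 0 1 (G.gridSize N)
        + a 1 (G.gridSize N) * b 1 (G.gridSize N) * S.C 1 1 (G.gridSize N)) ∧
      (G.gridSize N * L 1 N = a 3 (G.gridSize N) * S.C 1 0 (G.gridSize N)
        - b 3 (G.gridSize N) * S.C 0 1 (G.gridSize N)
        + 2 / 3 * (β₀ - α₀) * G.gridSize N * S.C 1 1 (G.gridSize N)) ∧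
      (G.gridSize N * L 2 N = a 5 (G.gridSize N) * S.C 1 0 (G.gridSize N)
        + b 5 (G.gridSize N) * S.C 0 1 (G.gridSize N)
        + e (G.gridSize N) * S.C 1 1 (G.gridSize N)) ∧
      (G.gridSize N * L 3 N = a 7 (G.gridSize N) * S.C 1 0 (G.gridSize N)
        - b 7 (G.gridSize N) * S.C 0 1 (G.gridSize N)
        + 8 / 7 * (α₀ - β₀) * G.gridSize N * S.C 1 1 (G.gridSize N)) := by
    filter_upwards [hpos] with N hN
    have h0 := hN.2.ne'
    simp only [hL, lhs_robinHarmonic S α₀ β₀ _ hN.1, Fin.sum_univ_two]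
    refine ⟨?_, ?_, ?_, ?_⟩ <;>
    · simp [Finset.Nat.antidiagonal_succ, edgePoly, Nat.factorial, a, b, e]
      field_simp
      ring
  -- The minor that multiplies `e` in the determinant; it vanishes at `h = 0`, where both odd rows
  -- are antisymmetric.
  have hK : ∀ h, a 3 h * b 7 h - a 7 h * b 3 h = 4 / 21 * (α₀ - β₀) * h := fun h => by
    simp only [a, b]; ring
  have hδ_eq : ∀ h, δ h = (α₀ - β₀) * (4 / 21 * e h + 8 / 7 * (a 3 h * b 5 h + a 5 h * b 3 h)
    + 2 / 3 * (a 5 h * b 7 h + a 7 h * b 5 h)) := fun _ => rfl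
  replace ht : ∀ n < 4, Tendsto (L n) atTop (𝓝 0) := ht
  -- The Cramer identities below are polynomial in `a`, `b`, `e`, and need only `hK` and the formula
  -- for `δ`.
  clear_value a b e δ L
  have h10 : Tendsto (fun N₁ : ℕ => S.C 1 0 (G.gridSize N₁)) atTop (𝓝 0) := by
    refine tendsto_zero_of_cramer hh (ht 1 (by norm_num)) (ht 2 (by norm_num)) (ht 3 (by norm_num))
      (M₁ := fun h => b 5 h * (8 / 7 * (α₀ - β₀) * h) + e h * b 7 h)
      (M₂ := fun h => b 3 h * (8 / 7 * (α₀ - β₀) * h) - 2 / 3 * (β₀ - α₀) * h * b 7 h)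
      (M₃ := fun h => -b 3 h * e h - 2 / 3 * (β₀ - α₀) * h * b 5 h)
      (by fun_prop) (by fun_prop) (by fun_prop) hδ hδ0 ?_
    filter_upwards [hpos, hrow] with N hN hr
    obtain ⟨-, r1, r2, r3⟩ := hr
    refine mul_left_cancel₀ hN.2.ne' ?_
    rw [hδ_eq]
    generalize G.gridSize N = h at *
    linear_combination
      -(b 5 h * (8 / 7 * (α₀ - β₀) * h) + e h * b 7 h) * r1
      - (b 3 h * (8 / 7 * (α₀ - β₀) * h) - 2 / 3 * (β₀ - α₀) * h * b 7 h) * r2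
      - (-b 3 h * e h - 2 / 3 * (β₀ - α₀) * h * b 5 h) * r3 - e h * S.C 1 0 h * hK h
  have h01 : Tendsto (fun N₁ : ℕ => S.C 0 1 (G.gridSize N₁)) atTop (𝓝 0) := by
    refine tendsto_zero_of_cramer hh (ht 1 (by norm_num)) (ht 2 (by norm_num)) (ht 3 (by norm_num))
      (M₁ := fun h => -(a 5 h * (8 / 7 * (α₀ - β₀) * h)) + e h * a 7 h)
      (M₂ := fun h => a 3 h * (8 / 7 * (α₀ - β₀) * h) - 2 / 3 * (β₀ - α₀) * h * a 7 h)
      (M₃ := fun h => -a 3 h * e h + 2 / 3 * (β₀ - α₀) * h * a 5 h)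
      (by fun_prop) (by fun_prop) (by fun_prop) hδ hδ0 ?_
    filter_upwards [hpos, hrow] with N hN hr
    obtain ⟨-, r1, r2, r3⟩ := hr
    refine mul_left_cancel₀ hN.2.ne' ?_
    rw [hδ_eq]
    generalize G.gridSize N = h at *
    linear_combination
      -(-(a 5 h * (8 / 7 * (α₀ - β₀) * h)) + e h * a 7 h) * r1
      - (a 3 h * (8 / 7 * (α₀ - β₀) * h) - 2 / 3 * (β₀ - α₀) * h * a 7 h) * r2
      - (-a 3 h * e h + 2 / 3 * (β₀ - α₀) * h * a 5 h) * r3 - e h * S.C 0 1 h * hK h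
  have h11 : Tendsto (fun N₁ : ℕ => S.C 1 1 (G.gridSize N₁)) atTop (𝓝 0) := by
    refine tendsto_zero_of_cramer hh (ht 1 (by norm_num)) (ht 2 (by norm_num)) (ht 3 (by norm_num))
      (M₁ := fun h => -(a 5 h * b 7 h) - b 5 h * a 7 h)
      (M₂ := fun h => a 3 h * b 7 h - b 3 h * a 7 h)
      (M₃ := fun h => a 3 h * b 5 h + b 3 h * a 5 h)
      (by fun_prop) (by fun_prop) (by fun_prop) hδ hδ0 ?_
    filter_upwards [hpos, hrow] with N hN hr
    obtain ⟨-, r1, r2, r3⟩ := hr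
    refine mul_left_cancel₀ hN.2.ne' ?_
    rw [hδ_eq]
    generalize G.gridSize N = h at *
    linear_combination
      -(-(a 5 h * b 7 h) - b 5 h * a 7 h) * r1 - (a 3 h * b 7 h - b 3 h * a 7 h) * r2
      - (a 3 h * b 5 h + b 3 h * a 5 h) * r3 - e h * S.C 1 1 h * hK h
  -- The row `n = 0` gives the corner weight from the other three.
  have h00 : Tendsto (fun N₁ : ℕ => S.C 0 0 (G.gridSize N₁)) atTop (𝓝 0) := by
    have hlim : ∀ {M : ℝ → ℝ}, Continuous M →
        Tendsto (fun N => M (G.gridSize N)) atTop (𝓝 (M 0)) := fun hM => (hM.tendsto 0).comp hh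
    have h1 := (((hh.mul (ht 0 (by norm_num))).sub ((hlim (ha 1)).mul h10)).sub
      ((hlim (hb 1)).mul h01)).sub (((hlim (ha 1)).mul (hlim (hb 1))).mul h11)
    simp only [mul_zero, sub_zero] at h1
    refine h1.congr' ?_
    filter_upwards [hrow] with N hr
    linear_combination hr.1
  fin_cases k <;> fin_cases j
  exacts [h00, h01, h10, h11]

theorem order_le_six {G : InterfaceDomain} {c : Coeffs} {a₀ α₀ β₀ : ℝ} (hc : c.IsRegular G ⊤)
    (ha : ∀ᶠ q in 𝓝[G.D] G.corner, c.a q = a₀) (hα : c.α = fun _ => α₀) (hβ : c.β = fun _ => β₀)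
    (hαβ : α₀ ≠ β₀) {S : CornerScheme} (hS : S.Nontrivial G) {p : ℕ} (hp : S.HasOrder G c ⊤ p) :
    p ≤ 6 := by
  by_contra h
  refine hS (tendsto_zero_of_isBigO hαβ fun n _ =>
    (lhs_robinHarmonic_isBigO hc ha hα hβ hp n).trans ?_)
  obtain ⟨r, hr⟩ := Nat.exists_eq_add_of_le (show 8 ≤ p + 1 by omega)
  have h1 : (fun N₁ : ℕ => G.gridSize N₁ ^ r) =O[atTop] fun _ => (1 : ℝ) :=
    ((continuous_pow r).tendsto (0 : ℝ) |>.comp G.tendsto_gridSize).isBigO_one ℝ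
  simpa [hr, pow_add] using (isBigO_refl (fun N₁ : ℕ => G.gridSize N₁ ^ 8) atTop).mul h1

theorem Coeffs.IsRegular.of_top {G : InterfaceDomain} {c : Coeffs} (hc : c.IsRegular G ⊤) :
    c.IsRegular G 5 where
  a_pos := hc.a_pos
  a_smooth := hc.a_smooth.of_le (by exact_mod_cast le_top)
  α_smooth := hc.α_smooth.of_le (by exact_mod_cast le_top)
  β_smooth := hc.β_smooth.of_le (by exact_mod_cast le_top)

theorem IsSolution.of_top {G : InterfaceDomain} {c : Coeffs} {u f : ℝ × ℝ → ℝ} {g₁ g₄ : ℝ → ℝ}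
    (hs : IsSolution G c ⊤ u f g₁ g₄) : IsSolution G c 5 u f g₁ g₄ where
  u_smooth := hs.u_smooth.of_le (by exact_mod_cast le_top)
  f_smooth := hs.f_smooth.of_le (by exact_mod_cast le_top)
  g₁_smooth := hs.g₁_smooth.of_le (by exact_mod_cast le_top)
  g₄_smooth := hs.g₄_smooth.of_le (by exact_mod_cast le_top)
  pde := hs.pde
  robin_left := hs.robin_left
  robin_top := hs.robin_top

theorem CornerScheme.nontrivial_of_isPolynomial {S : CornerScheme} {d : ℕ} (hS : S.IsPolynomial d)
    (h0 : S.C 0 0 0 ≠ 0) (G : InterfaceDomain) : S.Nontrivial G := by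
  intro h
  obtain ⟨P, -, hP⟩ := hS.C_poly 0 0
  have h1 : Tendsto (fun N₁ : ℕ => S.C 0 0 (G.gridSize N₁)) atTop (𝓝 (S.C 0 0 0)) := by
    simp only [hP]
    exact (P.continuous.tendsto 0).comp G.tendsto_gridSize
  exact h0 (tendsto_nhds_unique h1 (h 0 0))

end CornerFD

theorem theorem2p6 :
    -- a sixth-order 4-point scheme, built from the jet of the coefficients at the corner
    (∃ S : CornerFD.CornerJet → CornerFD.CornerScheme,
      ∀ (G : CornerFD.InterfaceDomain) (c : CornerFD.Coeffs), c.IsRegular G 5 →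
        (S (c.jet G 5)).M = 5 ∧
        (S (c.jet G 5)).IsPolynomial 6 ∧
        (∀ k j, (S (c.jet G 5)).C k j 0 ≠ 0) ∧
        (S (c.jet G 5)).HasOrder G c 5 6) ∧
    -- six is the maximum order for smooth `a`, `α`, `β` with distinct corner values of `α`, `β`
    (∀ (G : CornerFD.InterfaceDomain) (α₀ β₀ : ℝ), α₀ ≠ β₀ →
      IsGreatest {p : ℕ | ∀ c : CornerFD.Coeffs, c.IsRegular G ⊤ →
        c.α G.l₄ = α₀ → c.β G.l₁ = β₀ →
        ∃ S : CornerFD.CornerScheme, S.Nontrivial G ∧ S.HasOrder G c ⊤ p} 6) ∧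
    -- no scheme exceeds it when `α ≠ β` are constant and `a` is constant near the corner
    (∀ (G : CornerFD.InterfaceDomain) (c : CornerFD.Coeffs) (a₀ α₀ β₀ : ℝ), c.IsRegular G ⊤ →
      (∀ᶠ q in 𝓝[G.D] G.corner, c.a q = a₀) →
      c.α = (fun _ => α₀) → c.β = (fun _ => β₀) → α₀ ≠ β₀ →
      ∀ S : CornerFD.CornerScheme, S.Nontrivial G →
        ∀ p : ℕ, S.HasOrder G c ⊤ p → p ≤ 6) := by
  -- The scheme is chosen jet by jet, before the domain and the coefficients, so it depends on them
  -- only through the jet.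
  choose S hS using CornerFD.exists_sixth_order_scheme
  refine ⟨⟨S, fun G c hc => hS _ G c hc rfl⟩, fun G α₀ β₀ hαβ => ⟨fun c hc _ _ => ?_,
    fun p hp => ?_⟩, fun G c a₀ α₀ β₀ hc ha hα hβ hαβ T hT p hp =>
      CornerFD.order_le_six hc ha hα hβ hαβ hT hp⟩
  · obtain ⟨-, hpoly, hne, horder⟩ := hS _ G c hc.of_top rfl
    exact ⟨S (c.jet G 5), CornerFD.CornerScheme.nontrivial_of_isPolynomial hpoly (hne 0 0) G,
      fun u f g₁ g₄ hs => horder u f g₁ g₄ hs.of_top⟩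
  -- An admissible `p` must serve all coefficients with the given corner values, so the instance `a
  -- = 1` with constant `α`, `β` already bounds it.
  · have hc : CornerFD.Coeffs.IsRegular ⟨fun _ => 1, fun _ => α₀, fun _ => β₀⟩ G ⊤ :=
      ⟨fun _ _ => one_pos, contDiffOn_const, contDiffOn_const, contDiffOn_const⟩
    obtain ⟨T, hT, horder⟩ := hp _ hc rfl rfl
    exact CornerFD.order_le_six hc (Eventually.of_forall fun _ => rfl) rfl rfl hαβ hT horder
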